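/- Let $k\in\mathbb N$, let $\|\cdot\|$ be a norm on $\mathbb{R}^k$ such that $\|z\|$ is nondecreasing in each $|z_j|$, and let $\mathcal V\subseteq\{1,\dots,k\}$ with $k_+=|\mathcal V|$. Let $0<\gamma_2\le\gamma_1\le 1$ and $0<C_1\le C_2$. Let $X_1,X_2,\dots$ be i.i.d. random vectors in $\mathbb{R}^k$ with a probability density $p_X$ that is continuous at $0$ with $p_X(0)>0$, and let $\mathcal X$ be the support of their distribution. For $\gamma\in(0,1]$ and $C>0$ let $\Lambda_{+,\mathcal V}(\gamma,C)$ be the set of functions $f:\mathbb{R}^k\to\mathbb{R}$ such that $|f(x)-f(z)|\le C\|x-z\|^\gamma$ for all $x,z\in\mathcal X$, and $f(x)\ge f(z)$ whenever $x_j\ge z_j$ for all $j\in\mathcal V$ and $x_j=z_j$ for all $j\notin\mathcal V$. For design points $x_1,\dots,x_n$ and noise level $\sigma\equiv1$, define the ordered modulus of continuity at $0$ $$\omega(\delta,\mathcal F,\mathcal G)=\sup\Big\{g(0)-f(0):\ f\in\mathcal F,\ g\in\mathcal G,\ \sum_{i=1}^n (g(x_i)-f(x_i))^2\le\delta^2\Big\},$$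 and let $\omega_+(\delta,\mathcal F,\mathcal G)$ be the between class modulus, defined in the same way with $|g(0)-f(0)|$ in place of $g(0)-f(0)$. Write $\Lambda_j=\Lambda_{+,\mathcal V}(\gamma_j,C_j)$ for $j=1,2$, and $$r=\frac{1}{2+k_+/\gamma_1+(k-k_+)/\gamma_2}.$$ For $z\in\mathbb{R}^k$ let $(z)_{\mathcal V+}$ be the vector with coordinates $\max\{z_j,0\}$ for $j\in\mathcal V$ and $z_j$ for $j\notin\mathcal V$, let $(z)_{\mathcal V-}=(-z)_{\mathcal V+}$, and for $A\subseteq\{1,\dots,k\}$ let $z_{[A]}$ be the vector obtained from $z$ by setting the coordinates outside $A$ to $0$. Write $(t)_+=\max\{t,0\}$. Define $c^*_{1,2}$ and $c^*_{2,1}$, which depend only on the norm, $k$, $\mathcal V$, $\gamma_1,C_1,\gamma_2,C_2$ and on $p_X(0)$, by $$c^*_{1,2}=p_X(0)\int_{\{z:\,z_j\ge0\ \forall j\in\mathcal V\}}\big(1-C_1\|z_{[\mathcal V]}\|^{\gamma_1}-C_2\|z_{[\mathcal V^c]}\|^{\gamma_2}\big)_+^2\,dz,$$ $$c^*_{2,1}=p_X(0)\int_{\{z:\,z_j\le0\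 \forall j\in\mathcal V\}}\big(1-C_2\|z_{[\mathcal V^c]}\|^{\gamma_2}-C_1\|z_{[\mathcal V]}\|^{\gamma_1}\big)_+^2\,dz$$ if $\gamma_1>\gamma_2$, and by $$c^*_{1,2}=p_X(0)\int_{\mathbb{R}^k}\big(1-C_1\|(z)_{\mathcal V+}\|^{\gamma_1}-C_2\|(z)_{\mathcal V-}\|^{\gamma_2}\big)_+^2\,dz,$$ $$c^*_{2,1}=p_X(0)\int_{\mathbb{R}^k}\big(1-C_2\|(z)_{\mathcal V+}\|^{\gamma_2}-C_1\|(z)_{\mathcal V-}\|^{\gamma_1}\big)_+^2\,dz$$ if $\gamma_1=\gamma_2$. Then $c^*_{1,2}>0$ and $c^*_{2,1}>0$, and for almost every realization $(x_i)_{i\ge1}$ of $(X_i)_{i\ge1}$ and for all $\delta>0$, $$\lim_{n\to\infty}n^{r}\,\omega(\delta,\Lambda_1,\Lambda_2)=\big(\delta^2/c^*_{1,2}\big)^{r},\qquad \lim_{n\to\infty}n^{r}\,\omega(\delta,\Lambda_2,\Lambda_1)=\big(\delta^2/c^*_{2,1}\big)^{r}.$$ Consequently $n^{-r}$ is the minimax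 rate of adaptation, that is, the rate at which the between class modulus tends to zero: $$\lim_{n\to\infty}n^{r}\,\omega_+(\delta,\Lambda_1,\Lambda_2)=\big(\max\{\delta^2/c^*_{1,2},\,\delta^2/c^*_{2,1}\}\big)^{r}.$$ -/

import Mathlib

open MeasureTheory ProbabilityTheory Filter Topology

namespace MonotoneHolder

/-- The norms allowed on `ℝ^k`: `N` is a norm (a definite seminorm) and `N z` is nondecreasing in
each magnitude `|z j|`. -/
def IsMonotoneNorm {k : ℕ} (N : Seminorm ℝ (Fin k → ℝ)) : Prop :=
  (∀ z, N z = 0 → z = 0) ∧ ∀ x z : Fin k → ℝ, (∀ j, |x j| ≤ |z j|) → N x ≤ N z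

/-- The Hölder class `Λ(γ, C)`: functions on `ℝ^k` satisfying the Hölder condition on `S`. -/
def holderClass {k : ℕ} (N : Seminorm ℝ (Fin k → ℝ)) (S : Set (Fin k → ℝ)) (γ C : ℝ) :
    Set ((Fin k → ℝ) → ℝ) :=
  {f | ∀ x ∈ S, ∀ z ∈ S, |f x - f z| ≤ C * N (x - z) ^ γ}

/-- The coordinate-wise monotone Hölder class `Λ_{+,V}(γ, C)`: members of `Λ(γ, C)` that are
nondecreasing in the coordinates belonging to `V`. -/
def monotoneHolderClass {k : ℕ} (N : Seminorm ℝ (Fin k → ℝ)) (S : Set (Fin k → ℝ))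
    (V : Finset (Fin k)) (γ C : ℝ) : Set ((Fin k → ℝ) → ℝ) :=
  {f | f ∈ holderClass N S γ C ∧
    ∀ x z : Fin k → ℝ, (∀ j ∈ V, z j ≤ x j) → (∀ j ∉ V, x j = z j) → f z ≤ f x}

/-- The ordered class modulus of continuity `ω(δ, F, G)` of the functional `f ↦ f 0`, for the
design points `x 0, …, x (n - 1)` and the standard deviation function `σ`. -/
noncomputable def orderedModulus {k : ℕ} (σ : (Fin k → ℝ) → ℝ) (x : ℕ → Fin k → ℝ) (n : ℕ)
    (δ : ℝ) (F G : Set ((Fin k → ℝ) → ℝ)) : ℝ :=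
  sSup {t : ℝ | ∃ f ∈ F, ∃ g ∈ G,
    ∑ i ∈ Finset.range n, ((g (x i) - f (x i)) / σ (x i)) ^ 2 ≤ δ ^ 2 ∧ t = g 0 - f 0}

/-- The between class modulus of continuity `ω₊(δ, F, G)` of the functional `f ↦ f 0`. -/
noncomputable def betweenModulus {k : ℕ} (σ : (Fin k → ℝ) → ℝ) (x : ℕ → Fin k → ℝ) (n : ℕ)
    (δ : ℝ) (F G : Set ((Fin k → ℝ) → ℝ)) : ℝ :=
  sSup {t : ℝ | ∃ f ∈ F, ∃ g ∈ G,
    ∑ i ∈ Finset.range n, ((g (x i) - f (x i)) / σ (x i)) ^ 2 ≤ δ ^ 2 ∧ t = |g 0 - f 0|}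

/-- The rate exponent `r(γ₁, γ₂) = (2 + k₊ / γ₁ + (k - k₊) / γ₂)⁻¹`, where `k₊ = |V|`. -/
noncomputable def rateExponent {k : ℕ} (V : Finset (Fin k)) (γ₁ γ₂ : ℝ) : ℝ :=
  (2 + (V.card : ℝ) / γ₁ + ((k : ℝ) - (V.card : ℝ)) / γ₂)⁻¹

/-- `(z)_{V+}`: positive parts of the coordinates in `V`, the other coordinates unchanged. -/
noncomputable def posPartOn {k : ℕ} (V : Finset (Fin k)) (z : Fin k → ℝ) : Fin k → ℝ :=
  fun j => if j ∈ V then max (z j) 0 else z j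

/-- `(z)_{V-} = (-z)_{V+}`. -/
noncomputable def negPartOn {k : ℕ} (V : Finset (Fin k)) (z : Fin k → ℝ) : Fin k → ℝ :=
  posPartOn V (-z)

/-- The vector `(z_V, 0)`: coordinates outside `V` are set to zero. -/
def restrictTo {k : ℕ} (V : Finset (Fin k)) (z : Fin k → ℝ) : Fin k → ℝ :=
  fun j => if j ∈ V then z j else 0

/-- The function-space part of the constant `c*_{1,2}`. If `γ₁ > γ₂`, only the orthants on which all
coordinates in `V` are nonnegative contribute. -/
noncomputable def kappa12 {k : ℕ} (N : Seminorm ℝ (Fin k → ℝ)) (V : Finset (Fin k))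
    (γ₁ C₁ γ₂ C₂ : ℝ) : ℝ :=
  if γ₂ < γ₁ then
    ∫ z in {z : Fin k → ℝ | ∀ j ∈ V, 0 ≤ z j},
      (max (1 - C₁ * N (restrictTo V z) ^ γ₁ - C₂ * N (restrictTo Vᶜ z) ^ γ₂) 0) ^ 2
  else
    ∫ z : Fin k → ℝ,
      (max (1 - C₁ * N (posPartOn V z) ^ γ₁ - C₂ * N (negPartOn V z) ^ γ₂) 0) ^ 2

/-- The function-space part of the constant `c*_{2,1}`. If `γ₁ > γ₂`, only the orthants on which all
coordinates in `V` are nonpositive contribute. -/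
noncomputable def kappa21 {k : ℕ} (N : Seminorm ℝ (Fin k → ℝ)) (V : Finset (Fin k))
    (γ₁ C₁ γ₂ C₂ : ℝ) : ℝ :=
  if γ₂ < γ₁ then
    ∫ z in {z : Fin k → ℝ | ∀ j ∈ V, z j ≤ 0},
      (max (1 - C₂ * N (restrictTo Vᶜ z) ^ γ₂ - C₁ * N (restrictTo V z) ^ γ₁) 0) ^ 2
  else
    ∫ z : Fin k → ℝ,
      (max (1 - C₂ * N (posPartOn V z) ^ γ₂ - C₁ * N (negPartOn V z) ^ γ₁) 0) ^ 2

end MonotoneHolder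

/-! Suppose `f ∈ Λ₁`, `g ∈ Λ₂` and `g 0 - f 0 ≥ b`. Near the origin, raising the negative
`V`-coordinates to zero and then applying the Hölder bound gives `f x ≤ f 0 + C₁ * N (posPartOn V x)
^ γ₁`. Dually, `g x ≥ g 0 - C₂ * N (negPartOn V x) ^ γ₂`. Hence `|g - f|` dominates `profile b`
everywhere once `b` is small (`exists_forall_profile_le_abs_sub`), and an explicit pair attains it
(`exists_sub_eq_profile`). For small gaps the modulus is therefore found by inverting `b ↦ ∑ i,
profile b (x i) ^ 2`.

To find the size of this sum, stretch the `V`-coordinates by `b ^ (1 / γ₁)` and the others by `b ^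
(1 / γ₂)`. The Jacobian and the squared height together give the power `b ^ (1 / r)`. The rescaled
profile converges, with bounded support, to the integrand of `kappa12`; if `γ₁ > γ₂`, a negative
`V`-coordinate is penalized infinitely in the limit, which leaves only part of the space
(`tendsto_scaledProfile`, `tendsto_integral_profile`). With `b = c * n ^ (-r)` the expected sum
tends to `p 0 * kappa12 * c ^ (1 / r)`. A Chernoff bound and Borel–Cantelli make this almost sure
(`ae_tendsto_rowSum`), and equating the limit with `δ ^ 2` gives the constant
(`tendsto_orderedModulus`).

The reflection `f ↦ -f (-·)` turns the opposite order of classes into the same problem for the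
design `-X`, whose density has the same value at `0`. So the two constants agree, and the between
class modulus is the larger of the two ordered ones. -/

namespace MonotoneHolder

/-! ### Concentration and a strong law for triangular row sums -/

/-- Convexity bound for the moment generating function of a `[0, 1]`-valued variable. -/
theorem mgf_le_exp_of_mem_Icc {Ω : Type*} [MeasurableSpace Ω] {P : Measure Ω}
    [IsProbabilityMeasure P] {Y : Ω → ℝ} (hY : Measurable Y) (h0 : ∀ a, 0 ≤ Y a)
    (h1 : ∀ a, Y a ≤ 1) {t : ℝ} (ht : |t| ≤ 1) :
    mgf Y P t ≤ Real.exp ((∫ a, Y a ∂P) * (t + t ^ 2)) := by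
  have hint : Integrable Y P :=
    Integrable.of_bound hY.aestronglyMeasurable 1
      (ae_of_all _ fun a => by rw [Real.norm_eq_abs, abs_of_nonneg (h0 a)]; exact h1 a)
  have hexp : Real.exp t - 1 ≤ t + t ^ 2 := by
    have := (abs_le.1 (Real.abs_exp_sub_one_sub_id_le ht)).2
    linarith
  have hpt : ∀ a, Real.exp (t * Y a) ≤ 1 + Y a * (t + t ^ 2) := fun a => by
    -- On `[0, 1]` the convex function `y ↦ exp (t * y)` lies below its chord `1 + y * (exp t - 1)`.
    have hc := convexOn_exp.2 (Set.mem_univ (0 : ℝ)) (Set.mem_univ t)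
      (sub_nonneg.2 (h1 a)) (h0 a) (by ring)
    simp only [smul_eq_mul, mul_zero, zero_add, Real.exp_zero, mul_one] at hc
    rw [mul_comm t]
    nlinarith [mul_le_mul_of_nonneg_left hexp (h0 a)]
  calc mgf Y P t ≤ ∫ a, (1 + Y a * (t + t ^ 2)) ∂P :=
        integral_mono_of_nonneg (ae_of_all _ fun a => (Real.exp_pos _).le)
          ((integrable_const _).add (hint.mul_const _)) (ae_of_all _ hpt)
    _ = (∫ a, Y a ∂P) * (t + t ^ 2) + 1 := by
        rw [integral_add (integrable_const _) (hint.mul_const _), integral_mul_const]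
        simp [add_comm]
    _ ≤ _ := Real.add_one_le_exp _

/-- Chernoff's bound; the sign of `t` selects the tail. For `[0, 1]`-valued variables the
second-order term is controlled by the mean `q`, which is what makes the bound useful when `q` is
small. -/
theorem measureReal_deviation_le {Ω : Type*} [MeasurableSpace Ω] {P : Measure Ω}
    [IsProbabilityMeasure P] {Y : ℕ → Ω → ℝ} (hY : ∀ i, Measurable (Y i)) (hind : iIndepFun Y P)
    (h0 : ∀ i a, 0 ≤ Y i a) (h1 : ∀ i a, Y i a ≤ 1) {q : ℝ} (hq : ∀ i, ∫ a, Y i a ∂P = q)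
    {t : ℝ} (ht : |t| ≤ 1) (n : ℕ) (ε : ℝ) :
    P.real {a | ε ≤ t * (∑ i ∈ Finset.range n, Y i a - n * q)} ≤
      Real.exp (n * q * t ^ 2 - ε) := by
  have hS : Measurable (∑ i ∈ Finset.range n, Y i) := by
    rw [Finset.sum_fn]
    exact Finset.measurable_sum _ fun i _ => hY i
  have hset : {a | ε ≤ t * (∑ i ∈ Finset.range n, Y i a - n * q)} =
      {a | ε + t * (n * q) ≤ t * (∑ i ∈ Finset.range n, Y i) a} := by
    ext a
    simp only [Set.mem_ofPred_eq, Finset.sum_apply, mul_sub]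
    exact le_sub_iff_add_le
  have hSn : ∀ a, |(∑ i ∈ Finset.range n, Y i) a| ≤ n := fun a => by
    rw [Finset.sum_apply, abs_of_nonneg (Finset.sum_nonneg fun i _ => h0 i a)]
    calc _ ≤ ∑ i ∈ Finset.range n, (1 : ℝ) := Finset.sum_le_sum fun i _ => h1 i a
      _ = n := by simp
  have hint : Integrable (fun a => Real.exp (1 * (t * (∑ i ∈ Finset.range n, Y i) a))) P := by
    refine Integrable.of_bound (by fun_prop) (Real.exp n) (ae_of_all _ fun a => ?_)
    rw [Real.norm_eq_abs, Real.abs_exp, one_mul]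
    refine Real.exp_le_exp.2 ((le_abs_self _).trans ?_)
    rw [abs_mul]
    calc _ ≤ 1 * (n : ℝ) := mul_le_mul ht (hSn a) (abs_nonneg _) zero_le_one
      _ = n := one_mul _
  have hch := measure_ge_le_exp_mul_mgf (μ := P) (ε + t * (n * q)) zero_le_one hint
  rw [hset]
  refine hch.trans ?_
  have hm : mgf (fun a => t * (∑ i ∈ Finset.range n, Y i) a) P 1 =
      mgf (∑ i ∈ Finset.range n, Y i) P t := by
    simp only [mgf, one_mul]
  rw [hm, hind.mgf_sum hY]
  have hprod : ∏ i ∈ Finset.range n, mgf (Y i) P t ≤ Real.exp (q * (t + t ^ 2)) ^ n := by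
    calc _ ≤ ∏ i ∈ Finset.range n, Real.exp (q * (t + t ^ 2)) :=
          Finset.prod_le_prod (fun i _ => mgf_nonneg) fun i _ => by
            rw [← hq i]; exact mgf_le_exp_of_mem_Icc (hY i) (h0 i) (h1 i) ht
      _ = _ := by simp
  calc _ ≤ Real.exp (-1 * (ε + t * (n * q))) * Real.exp (q * (t + t ^ 2)) ^ n :=
        mul_le_mul_of_nonneg_left hprod (Real.exp_pos _).le
    _ = _ := by
        rw [← Real.exp_nat_mul, ← Real.exp_add]
        congr 1
        ring

/-- A law of large numbers for the row sums `∑_{i < n} φ n (X i)` of bounded nonnegative functions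
whose bounds `B n` tend to zero so fast that `exp (-(η / B n))` is summable for all `η > 0`. -/
theorem ae_tendsto_rowSum {Ω E : Type*} [MeasurableSpace Ω] [MeasurableSpace E] {P : Measure Ω}
    [IsProbabilityMeasure P] {X : ℕ → Ω → E} (hX : ∀ i, Measurable (X i)) (hind : iIndepFun X P)
    {μ : Measure E} (hlaw : ∀ i, P.map (X i) = μ) {φ : ℕ → E → ℝ} (hφ : ∀ n, Measurable (φ n))
    {B : ℕ → ℝ} (h0 : ∀ n x, 0 ≤ φ n x) (hB : ∀ n x, φ n x ≤ B n) (hBpos : ∀ᶠ n in atTop, 0 < B n)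
    (hsum : ∀ η : ℝ, 0 < η → Summable fun n => Real.exp (-(η / B n)))
    {L : ℝ} (hL : Tendsto (fun n : ℕ => n * ∫ x, φ n x ∂μ) atTop (𝓝 L)) :
    ∀ᵐ a ∂P, Tendsto (fun n => ∑ i ∈ Finset.range n, φ n (X i a)) atTop (𝓝 L) := by
  have hLnn : 0 ≤ L := ge_of_tendsto' hL fun n =>
    mul_nonneg (Nat.cast_nonneg _) (integral_nonneg (h0 n))
  have hdev : ∀ ε : ℝ, 0 < ε → ∀ s : ℝ, |s| = 1 → ∀ᵐ a ∂P, ∀ᶠ n : ℕ in atTop,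
      s * (∑ i ∈ Finset.range n, φ n (X i a) - n * ∫ x, φ n x ∂μ) < ε := by
    intro ε hε s hs
    -- After division by `B n` the Chernoff exponent is at most `((L + 1) * τ ^ 2 - τ * ε) / B n`.
    -- The choice `(L + 1) * τ ≤ ε / 2` lets half of the linear term absorb the quadratic one.
    set τ : ℝ := min 1 (ε / (2 * (L + 1))) with hτ
    have hτ0 : 0 < τ := lt_min one_pos (by positivity)
    have hτ1 : τ ≤ 1 := min_le_left _ _
    have hτ2 : (L + 1) * τ ≤ ε / 2 := by
      have := min_le_right 1 (ε / (2 * (L + 1)))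
      rw [← hτ, le_div_iff₀ (by positivity)] at this
      linarith
    have hbound : ∀ᶠ n : ℕ in atTop,
        P.real {a | ε ≤ s * (∑ i ∈ Finset.range n, φ n (X i a) - n * ∫ x, φ n x ∂μ)} ≤
          Real.exp (-((τ * ε / 2) / B n)) := by
      filter_upwards [hBpos, hL.eventually (gt_mem_nhds (lt_add_one L))] with n hn hLn
      have hY : ∀ i, Measurable fun a => φ n (X i a) / B n := fun i =>
        ((hφ n).comp (hX i)).div_const _
      have hind' : iIndepFun (fun i a => φ n (X i a) / B n) P :=
        hind.comp (fun _ x => φ n x / B n) fun _ => (hφ n).div_const _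
      have hq : ∀ i, ∫ a, φ n (X i a) / B n ∂P = (∫ x, φ n x ∂μ) / B n := fun i => by
        rw [integral_div, ← hlaw i, integral_map (hX i).aemeasurable
          (hφ n).aestronglyMeasurable]
      have hdev := measureReal_deviation_le hY hind'
        (fun i a => div_nonneg (h0 _ _) hn.le) (fun i a => (div_le_one hn).2 (hB _ _)) hq
        (t := s * τ) (by rw [abs_mul, hs, one_mul, abs_of_pos hτ0]; exact hτ1) n (τ * ε / B n)
      refine (le_of_eq ?_).trans (hdev.trans (Real.exp_le_exp.2 ?_))
      · congr 1
        ext a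
        simp only [Set.mem_ofPred_eq]
        rw [← Finset.sum_div, mul_div_assoc', ← sub_div, mul_div_assoc', div_le_div_iff_of_pos_right hn,
          mul_comm s τ, mul_assoc, mul_le_mul_iff_right₀ hτ0]
      · have hs2 : s ^ 2 = 1 := by rw [← sq_abs, hs, one_pow]
        rw [mul_pow, hs2, one_mul, mul_div_assoc', div_mul_eq_mul_div, ← sub_div, ← neg_div,
          div_le_div_iff_of_pos_right hn]
        nlinarith [mul_le_mul_of_nonneg_right hLn.le (sq_nonneg τ),
          mul_le_mul_of_nonneg_right hτ2 hτ0.le]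
    have hsm : Summable fun n : ℕ =>
        P.real {a | ε ≤ s * (∑ i ∈ Finset.range n, φ n (X i a) - n * ∫ x, φ n x ∂μ)} :=
      Summable.of_norm_bounded_eventually_nat (hsum (τ * ε / 2) (by positivity)) (by
        filter_upwards [hbound] with n hn
        rwa [Real.norm_eq_abs, abs_of_nonneg measureReal_nonneg])
    have hfin : ∑' n : ℕ,
        P {a | ε ≤ s * (∑ i ∈ Finset.range n, φ n (X i a) - n * ∫ x, φ n x ∂μ)} ≠ ⊤ := by
      have := hsm.tsum_ofReal_ne_top
      simpa only [measureReal_def, ENNReal.ofReal_toReal (measure_ne_top _ _)] using this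
    filter_upwards [ae_eventually_notMem hfin] with a ha
    exact ha.mono fun n hn => lt_of_not_ge hn
  have hall : ∀ᵐ a ∂P, ∀ m : ℕ, ∀ᶠ n : ℕ in atTop,
      |∑ i ∈ Finset.range n, φ n (X i a) - n * ∫ x, φ n x ∂μ| < 1 / ((m : ℝ) + 1) := by
    refine ae_all_iff.2 fun m => ?_
    have hm : (0 : ℝ) < 1 / ((m : ℝ) + 1) := by positivity
    filter_upwards [hdev _ hm 1 (by simp), hdev _ hm (-1) (by simp)] with a h1 h2
    filter_upwards [h1, h2] with n h1 h2
    exact abs_lt.2 ⟨by linarith, by linarith⟩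
  filter_upwards [hall] with a ha
  have hz : Tendsto (fun n : ℕ => ∑ i ∈ Finset.range n, φ n (X i a) - n * ∫ x, φ n x ∂μ)
      atTop (𝓝 0) := by
    refine Metric.tendsto_nhds.2 fun ε hε => ?_
    obtain ⟨m, hm⟩ := exists_nat_one_div_lt hε
    exact (ha m).mono fun n hn => by simpa using hn.trans hm
  simpa using hz.add hL

theorem summable_exp_neg_div_rpow {c s : ℝ} (hc : 0 < c) (hs : 0 < s) :
    Summable fun n : ℕ => Real.exp (-(c / (n : ℝ) ^ (-s))) := by
  have hlim : Tendsto (fun n : ℕ => (n : ℝ) ^ s) atTop atTop :=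
    (tendsto_rpow_atTop hs).comp tendsto_natCast_atTop_atTop
  -- The exponent `-2 / s` turns into the summable power `n ^ (-2)` after substituting `n ^ s`.
  have ho := ((isLittleO_exp_neg_mul_rpow_atTop hc (-2 / s)).comp_tendsto hlim).isBigO
  refine summable_of_isBigO_nat (Real.summable_nat_rpow.2 (by norm_num : (-2 : ℝ) < -1)) ?_
  refine ho.congr (fun n => ?_) fun n => ?_
  · simp only [Function.comp]
    rw [Real.rpow_neg (Nat.cast_nonneg _), div_inv_eq_mul, neg_mul]
  · simp only [Function.comp]
    rw [← Real.rpow_mul (Nat.cast_nonneg _), mul_div_cancel₀ _ hs.ne']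

/-! ### Monotone norms and positive parts -/

section MonotoneNorm

variable {k : ℕ} {N : Seminorm ℝ (Fin k → ℝ)} {V : Finset (Fin k)}

theorem IsMonotoneNorm.eq_of_abs_eq (hN : IsMonotoneNorm N) {x z : Fin k → ℝ}
    (h : ∀ j, |x j| = |z j|) : N x = N z :=
  le_antisymm (hN.2 _ _ fun j => (h j).le) (hN.2 _ _ fun j => (h j).ge)

theorem IsMonotoneNorm.le_norm_mul (hN : IsMonotoneNorm N) (x : Fin k → ℝ) :
    N x ≤ ‖x‖ * N 1 := by
  have h : N (‖x‖ • (1 : Fin k → ℝ)) = ‖x‖ * N 1 := by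
    rw [map_smul_eq_mul, norm_norm]
  rw [← h]
  refine hN.2 _ _ fun j => ?_
  simpa using norm_le_pi_norm x j

theorem IsMonotoneNorm.continuous (hN : IsMonotoneNorm N) : Continuous N := by
  refine (LipschitzWith.of_le_add_mul (N 1).toNNReal fun x z => ?_).continuous
  rw [Real.coe_toNNReal _ (apply_nonneg N 1), dist_eq_norm, mul_comm]
  calc N x = N (z + (x - z)) := by rw [add_sub_cancel]
    _ ≤ N z + N (x - z) := map_add_le_add N _ _
    _ ≤ _ := by gcongr; exact hN.le_norm_mul _

theorem IsMonotoneNorm.single_pos (hN : IsMonotoneNorm N) (j : Fin k) :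
    0 < N (Pi.single j (1 : ℝ)) := by
  refine lt_of_le_of_ne (apply_nonneg _ _) fun h => ?_
  have := congrFun (hN.1 _ h.symm) j
  simp at this

/-- Setting the other coordinates to zero cannot increase a monotone norm. Bounds on `N` thus become
bounds on coordinates. -/
theorem IsMonotoneNorm.abs_mul_single_le (hN : IsMonotoneNorm N) (x : Fin k → ℝ) (j : Fin k) :
    |x j| * N (Pi.single j (1 : ℝ)) ≤ N x := by
  have h : N (x j • Pi.single j (1 : ℝ)) = |x j| * N (Pi.single j (1 : ℝ)) := by
    rw [map_smul_eq_mul, Real.norm_eq_abs]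
  rw [← h]
  refine hN.2 _ _ fun i => ?_
  by_cases hi : i = j
  · subst hi; simp
  · simp [hi]

theorem abs_posPartOn_le (x : Fin k → ℝ) (j : Fin k) : |posPartOn V x j| ≤ |x j| := by
  unfold posPartOn
  split_ifs
  · simpa using abs_max_sub_max_le_abs (x j) 0 0
  · exact le_rfl

theorem abs_posPartOn_sub_le (x z : Fin k → ℝ) (j : Fin k) :
    |posPartOn V x j - posPartOn V z j| ≤ |x j - z j| := by
  unfold posPartOn
  split_ifs
  · exact abs_max_sub_max_le_abs _ _ _
  · exact le_rfl

theorem posPartOn_zero : posPartOn V (0 : Fin k → ℝ) = 0 := by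
  ext j; simp [posPartOn]

theorem norm_posPartOn_le (x : Fin k → ℝ) : ‖posPartOn V x‖ ≤ ‖x‖ :=
  (pi_norm_le_iff_of_nonneg (norm_nonneg _)).2 fun j =>
    (abs_posPartOn_le x j).trans (norm_le_pi_norm x j)

theorem continuous_posPartOn : Continuous (posPartOn V) := by
  refine continuous_pi fun j => ?_
  unfold posPartOn
  split_ifs <;> fun_prop

theorem continuous_negPartOn : Continuous (negPartOn V) :=
  continuous_posPartOn.comp continuous_neg

theorem abs_rpow_sub_rpow_le {a b γ : ℝ} (ha : 0 ≤ a) (hb : 0 ≤ b) (h0 : 0 ≤ γ) (h1 : γ ≤ 1) :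
    |a ^ γ - b ^ γ| ≤ |a - b| ^ γ := by
  wlog hab : b ≤ a generalizing a b
  · rw [abs_sub_comm, abs_sub_comm a]
    exact this hb ha (le_of_not_ge hab)
  rw [abs_of_nonneg (sub_nonneg.2 hab),
    abs_of_nonneg (sub_nonneg.2 (Real.rpow_le_rpow hb hab h0))]
  have := Real.rpow_add_le_add_rpow hb (sub_nonneg.2 hab) h0 h1
  rw [add_sub_cancel] at this
  linarith

end MonotoneNorm

/-! ### Closure properties of the monotone Hölder classes and their one-sided envelopes -/

section Classes

variable {k : ℕ} {N : Seminorm ℝ (Fin k → ℝ)} {S : Set (Fin k → ℝ)} {V : Finset (Fin k)}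
  {γ C : ℝ} {f g : (Fin k → ℝ) → ℝ}

theorem posPartOn_mem_monotoneHolderClass (hN : IsMonotoneNorm N) (h0 : 0 ≤ γ) (h1 : γ ≤ 1)
    (hC : 0 ≤ C) : (fun x => C * N (posPartOn V x) ^ γ) ∈ monotoneHolderClass N S V γ C := by
  refine ⟨fun x _ z _ => ?_, fun x z h h' => ?_⟩
  · rw [← mul_sub, abs_mul, abs_of_nonneg hC]
    refine mul_le_mul_of_nonneg_left ?_ hC
    refine (abs_rpow_sub_rpow_le (apply_nonneg _ _) (apply_nonneg _ _) h0 h1).trans ?_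
    refine Real.rpow_le_rpow (abs_nonneg _) ((abs_sub_map_le_sub N _ _).trans ?_) h0
    exact hN.2 _ _ fun j => abs_posPartOn_sub_le x z j
  · refine mul_le_mul_of_nonneg_left (Real.rpow_le_rpow (apply_nonneg _ _) ?_ h0) hC
    refine hN.2 _ _ fun j => ?_
    unfold posPartOn
    split_ifs with hj
    · rw [abs_of_nonneg (le_max_right _ _), abs_of_nonneg (le_max_right _ _)]
      exact max_le_max_right _ (h j hj)
    · rw [h' j hj]

theorem const_mem_monotoneHolderClass (hC : 0 ≤ C) (c : ℝ) :
    (fun _ => c) ∈ monotoneHolderClass N S V γ C :=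
  ⟨fun x _ z _ => by
    rw [sub_self, abs_zero]
    exact mul_nonneg hC (Real.rpow_nonneg (apply_nonneg _ _) _), fun _ _ _ _ => le_rfl⟩

theorem const_add_mem_monotoneHolderClass (hf : f ∈ monotoneHolderClass N S V γ C) (c : ℝ) :
    (fun x => c + f x) ∈ monotoneHolderClass N S V γ C :=
  ⟨fun x hx z hz => by simpa using hf.1 x hx z hz, fun x z h h' => by
    simpa using hf.2 x z h h'⟩

theorem min_mem_monotoneHolderClass (hf : f ∈ monotoneHolderClass N S V γ C)
    (hg : g ∈ monotoneHolderClass N S V γ C) :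
    (fun x => min (f x) (g x)) ∈ monotoneHolderClass N S V γ C :=
  ⟨fun x hx z hz => (abs_min_sub_min_le_max _ _ _ _).trans
    (max_le (hf.1 x hx z hz) (hg.1 x hx z hz)), fun x z h h' =>
    min_le_min (hf.2 x z h h') (hg.2 x z h h')⟩

theorem max_mem_monotoneHolderClass (hf : f ∈ monotoneHolderClass N S V γ C)
    (hg : g ∈ monotoneHolderClass N S V γ C) :
    (fun x => max (f x) (g x)) ∈ monotoneHolderClass N S V γ C :=
  ⟨fun x hx z hz => (abs_max_sub_max_le_max _ _ _ _).trans
    (max_le (hf.1 x hx z hz) (hg.1 x hx z hz)), fun x z h h' =>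
    max_le_max (hf.2 x z h h') (hg.2 x z h h')⟩

/-- The two sign changes each reverse the order, so monotonicity survives. This symmetry yields the
lower envelope from the upper one and exchanges the roles of the two classes. -/
theorem reflect_mem_monotoneHolderClass (hf : f ∈ monotoneHolderClass N S V γ C) :
    (fun x => -f (-x)) ∈ monotoneHolderClass N (-S) V γ C := by
  refine ⟨fun x hx z hz => ?_, fun x z h h' => ?_⟩
  · have := hf.1 (-z) hz (-x) hx
    rw [neg_sub_neg] at this
    rwa [neg_sub_neg]
  · exact neg_le_neg (hf.2 (-z) (-x) (fun j hj => neg_le_neg (h j hj))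
      fun j hj => congrArg Neg.neg (h' j hj).symm)

/-- Functions with oscillation at most `C₂` pass from a smoother to a rougher Hölder class. -/
theorem mem_monotoneHolderClass_of_osc_le {γ₁ C₁ γ₂ C₂ : ℝ} (hγ₂ : 0 < γ₂) (hγ : γ₂ ≤ γ₁)
    (hC₁ : 0 ≤ C₁) (hC : C₁ ≤ C₂) (hf : f ∈ monotoneHolderClass N S V γ₁ C₁)
    (hosc : ∀ x z, |f x - f z| ≤ C₂) : f ∈ monotoneHolderClass N S V γ₂ C₂ := by
  refine ⟨fun x hx z hz => ?_, hf.2⟩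
  have hn : 0 ≤ N (x - z) := apply_nonneg _ _
  rcases le_total (N (x - z)) 1 with h | h
  · refine (hf.1 x hx z hz).trans (mul_le_mul hC ?_ (Real.rpow_nonneg hn _) (hC₁.trans hC))
    rcases hn.eq_or_lt with h0 | h0
    · rw [← h0, Real.zero_rpow hγ₂.ne', Real.zero_rpow (hγ₂.trans_le hγ).ne']
    · exact Real.rpow_le_rpow_of_exponent_ge h0 h hγ
  · calc _ ≤ C₂ * 1 := by rw [mul_one]; exact hosc x z
      _ ≤ _ := mul_le_mul_of_nonneg_left (Real.one_le_rpow h hγ₂.le) (hC₁.trans hC)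

/-- The positive part lies above `x` in the partial order and is no longer than `x`, so it stays in
the ball where the Hölder condition is available. -/
theorem le_add_of_mem_monotoneHolderClass (hf : f ∈ monotoneHolderClass N S V γ C) {ρ : ℝ}
    (hS : Metric.ball 0 ρ ⊆ S) {x : Fin k → ℝ} (hx : ‖x‖ < ρ) :
    f x ≤ f 0 + C * N (posPartOn V x) ^ γ := by
  have h1 : f x ≤ f (posPartOn V x) := hf.2 _ _
    (fun j hj => by simp [posPartOn, hj]) (fun j hj => by simp [posPartOn, hj])
  have h2 := hf.1 (posPartOn V x)
    (hS (by simpa using (norm_posPartOn_le x).trans_lt hx)) 0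
    (hS (by simpa using (norm_nonneg x).trans_lt hx))
  rw [sub_zero] at h2
  linarith [(abs_le.1 h2).2]

theorem le_of_mem_monotoneHolderClass (hg : g ∈ monotoneHolderClass N S V γ C) {ρ : ℝ}
    (hS : Metric.ball 0 ρ ⊆ S) {x : Fin k → ℝ} (hx : ‖x‖ < ρ) :
    g 0 - C * N (negPartOn V x) ^ γ ≤ g x := by
  have h := le_add_of_mem_monotoneHolderClass (reflect_mem_monotoneHolderClass hg) (ρ := ρ)
    (fun z hz => hS (by simpa using hz)) (x := -x) (by simpa using hx)
  rw [neg_neg, neg_zero] at h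
  unfold negPartOn
  linarith

end Classes

/-! ### The extremal profile and its anisotropic scaling -/

section Profile

variable {k : ℕ}

/-- The difference of the least favorable pair of functions with gap `b` at the origin. -/
noncomputable def profile (N : Seminorm ℝ (Fin k → ℝ)) (V : Finset (Fin k)) (γ₁ C₁ γ₂ C₂ b : ℝ)
    (x : Fin k → ℝ) : ℝ :=
  max (b - C₁ * N (posPartOn V x) ^ γ₁ - C₂ * N (negPartOn V x) ^ γ₂) 0

/-- The anisotropic dilation under which `profile` is self-similar. -/
noncomputable def dilation (V : Finset (Fin k)) (γ₁ γ₂ b : ℝ) : Fin k → ℝ :=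
  fun j => b ^ (if j ∈ V then 1 / γ₁ else 1 / γ₂)

/-- The profile with gap one in dilated coordinates; `s` is the ratio of the two scales. -/
noncomputable def scaledProfile (N : Seminorm ℝ (Fin k → ℝ)) (V : Finset (Fin k))
    (γ₁ C₁ γ₂ C₂ s : ℝ) (z : Fin k → ℝ) : ℝ :=
  max (1 - C₁ * N (fun j => if j ∈ V then max (z j) 0 else s * z j) ^ γ₁ -
    C₂ * N (fun j => if j ∈ V then s⁻¹ * max (-z j) 0 else -z j) ^ γ₂) 0

variable {N : Seminorm ℝ (Fin k → ℝ)} {V : Finset (Fin k)} {γ₁ C₁ γ₂ C₂ : ℝ}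

theorem profile_nonneg (b : ℝ) (x : Fin k → ℝ) : 0 ≤ profile N V γ₁ C₁ γ₂ C₂ b x :=
  le_max_right _ _

theorem profile_le (hC₁ : 0 ≤ C₁) (hC₂ : 0 ≤ C₂) {b : ℝ} (hb : 0 ≤ b) (x : Fin k → ℝ) :
    profile N V γ₁ C₁ γ₂ C₂ b x ≤ b := by
  refine max_le ?_ hb
  have h1 := mul_nonneg hC₁ (Real.rpow_nonneg (apply_nonneg N (posPartOn V x)) γ₁)
  have h2 := mul_nonneg hC₂ (Real.rpow_nonneg (apply_nonneg N (negPartOn V x)) γ₂)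
  linarith

theorem scaledProfile_nonneg (s : ℝ) (x : Fin k → ℝ) : 0 ≤ scaledProfile N V γ₁ C₁ γ₂ C₂ s x :=
  le_max_right _ _

theorem scaledProfile_le_one (hC₁ : 0 ≤ C₁) (hC₂ : 0 ≤ C₂) (s : ℝ) (x : Fin k → ℝ) :
    scaledProfile N V γ₁ C₁ γ₂ C₂ s x ≤ 1 := by
  refine max_le ?_ zero_le_one
  have h1 := mul_nonneg hC₁ (Real.rpow_nonneg
    (apply_nonneg N (fun j => if j ∈ V then max (x j) 0 else s * x j)) γ₁)
  have h2 := mul_nonneg hC₂ (Real.rpow_nonneg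
    (apply_nonneg N (fun j => if j ∈ V then s⁻¹ * max (-x j) 0 else -x j)) γ₂)
  linarith

theorem continuous_profile (hN : IsMonotoneNorm N) (h₁ : 0 ≤ γ₁) (h₂ : 0 ≤ γ₂) (b : ℝ) :
    Continuous (profile N V γ₁ C₁ γ₂ C₂ b) := by
  have h1 : Continuous fun x => N (posPartOn V x) ^ γ₁ :=
    (hN.continuous.comp continuous_posPartOn).rpow_const fun _ => Or.inr h₁
  have h2 : Continuous fun x => N (negPartOn V x) ^ γ₂ :=
    (hN.continuous.comp continuous_negPartOn).rpow_const fun _ => Or.inr h₂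
  unfold profile
  fun_prop

theorem profile_dilation (h₁ : 0 < γ₁) (h₂ : 0 < γ₂) {b : ℝ} (hb : 0 < b) (z : Fin k → ℝ) :
    profile N V γ₁ C₁ γ₂ C₂ b (dilation V γ₁ γ₂ b * z) =
      b * scaledProfile N V γ₁ C₁ γ₂ C₂ (b ^ (1 / γ₂ - 1 / γ₁)) z := by
  have hmax : ∀ c t : ℝ, 0 ≤ c → max (c * t) 0 = c * max t 0 := fun c t hc => by
    rw [← mul_zero c, ← mul_max_of_nonneg _ _ hc, mul_zero]
  have hp : posPartOn V (dilation V γ₁ γ₂ b * z) = b ^ (1 / γ₁) •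
      (fun j => if j ∈ V then max (z j) 0 else b ^ (1 / γ₂ - 1 / γ₁) * z j) := by
    ext j
    by_cases hj : j ∈ V
    · simp only [posPartOn, dilation, hj, if_true, Pi.mul_apply, Pi.smul_apply, smul_eq_mul]
      exact hmax _ _ (Real.rpow_nonneg hb.le _)
    · simp only [posPartOn, dilation, hj, if_false, Pi.mul_apply, Pi.smul_apply, smul_eq_mul]
      rw [← mul_assoc, ← Real.rpow_add hb]
      congr 2
      ring
  have hn : negPartOn V (dilation V γ₁ γ₂ b * z) = b ^ (1 / γ₂) •
      (fun j => if j ∈ V then (b ^ (1 / γ₂ - 1 / γ₁))⁻¹ * max (-z j) 0 else -z j) := by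
    ext j
    by_cases hj : j ∈ V
    · simp only [negPartOn, posPartOn, dilation, hj, if_true, Pi.mul_apply, Pi.smul_apply,
        Pi.neg_apply, smul_eq_mul]
      rw [← mul_neg, hmax _ _ (Real.rpow_nonneg hb.le _), ← mul_assoc, ← Real.rpow_neg hb.le,
        ← Real.rpow_add hb]
      congr 2
      ring
    · simp only [negPartOn, posPartOn, dilation, hj, if_false, Pi.mul_apply, Pi.smul_apply,
        Pi.neg_apply, smul_eq_mul]
      ring
  have hpow : ∀ (γ : ℝ) (v : Fin k → ℝ), 0 < γ → N (b ^ (1 / γ) • v) ^ γ = b * N v ^ γ := by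
    intro γ v hγ
    have hb' : 0 ≤ b ^ (1 / γ) := Real.rpow_nonneg hb.le _
    rw [map_smul_eq_mul, Real.norm_eq_abs, abs_of_nonneg hb',
      Real.mul_rpow hb' (apply_nonneg _ _), ← Real.rpow_mul hb.le, one_div_mul_cancel hγ.ne',
      Real.rpow_one]
  unfold profile scaledProfile
  rw [hp, hn, hpow _ _ h₁, hpow _ _ h₂, ← hmax _ _ hb.le]
  congr 1
  ring

/-- Positivity bounds both norm arguments, and every `|z j|` is dominated by a coordinate of one of
them. Uniformity in `s` holds because the factor `s` is never used (the second argument covers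
coordinates outside `V`) and `s⁻¹ ≥ 1`. -/
theorem exists_norm_le_of_scaledProfile_pos (hN : IsMonotoneNorm N) (h₁ : 0 < γ₁) (h₂ : 0 < γ₂)
    (hC₁ : 0 < C₁) (hC₂ : 0 < C₂) : ∃ R : ℝ, 0 < R ∧ ∀ s : ℝ, 0 < s → s ≤ 1 → ∀ z : Fin k → ℝ,
      0 < scaledProfile N V γ₁ C₁ γ₂ C₂ s z → ‖z‖ ≤ R := by
  have hpow : ∀ {γ C t : ℝ}, 0 < γ → 0 < C → 0 ≤ t → C * t ^ γ ≤ 1 → t ≤ C⁻¹ ^ (1 / γ) := by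
    intro γ C t hγ hC ht h
    have h' : t ^ γ ≤ C⁻¹ := by
      rw [inv_eq_one_div, le_div_iff₀ hC, mul_comm]
      exact h
    calc t = (t ^ γ) ^ (1 / γ) := by
          rw [← Real.rpow_mul ht, mul_one_div_cancel hγ.ne', Real.rpow_one]
      _ ≤ _ := Real.rpow_le_rpow (Real.rpow_nonneg ht _) h' (one_div_nonneg.2 hγ.le)
  set D : ℝ := C₁⁻¹ ^ (1 / γ₁) + C₂⁻¹ ^ (1 / γ₂) with hD
  have hD1 : 0 < C₁⁻¹ ^ (1 / γ₁) := by positivity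
  have hD2 : 0 < C₂⁻¹ ^ (1 / γ₂) := by positivity
  have hc : ∀ j, 0 ≤ D / N (Pi.single j (1 : ℝ)) := fun j =>
    div_nonneg (by positivity) (apply_nonneg _ _)
  have hsum0 : 0 ≤ ∑ j, D / N (Pi.single j (1 : ℝ)) := Finset.sum_nonneg fun j _ => hc j
  -- The summand `1` keeps the radius positive when `k = 0`.
  refine ⟨1 + ∑ j, D / N (Pi.single j (1 : ℝ)), by positivity,
    fun s hs hs1 z hz => ?_⟩
  have hz' : 0 < 1 - C₁ * N (fun j => if j ∈ V then max (z j) 0 else s * z j) ^ γ₁ -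
      C₂ * N (fun j => if j ∈ V then s⁻¹ * max (-z j) 0 else -z j) ^ γ₂ := by
    by_contra h
    exact hz.ne' (max_eq_right (not_lt.1 h))
  set a := fun j => if j ∈ V then max (z j) 0 else s * z j with ha
  set c := fun j => if j ∈ V then s⁻¹ * max (-z j) 0 else -z j with hcdef
  have hna := mul_nonneg hC₁.le (Real.rpow_nonneg (apply_nonneg N a) γ₁)
  have hnc := mul_nonneg hC₂.le (Real.rpow_nonneg (apply_nonneg N c) γ₂)
  have hNa : N a ≤ D := (hpow h₁ hC₁ (apply_nonneg _ _) (by linarith)).trans (by linarith)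
  have hNc : N c ≤ D := (hpow h₂ hC₂ (apply_nonneg _ _) (by linarith)).trans (by linarith)
  have hor : ∀ j, |z j| ≤ |a j| ∨ |z j| ≤ |c j| := by
    intro j
    by_cases hj : j ∈ V
    · rcases le_total 0 (z j) with h | h
      · left; simp [ha, hj, h]
      · right
        simp only [hcdef, hj, if_true]
        rw [max_eq_left (by linarith), abs_mul, abs_neg, abs_of_pos (inv_pos.2 hs)]
        exact le_mul_of_one_le_left (abs_nonneg _) ((one_le_inv₀ hs).2 hs1)
    · right; simp [hcdef, hj]
  refine (pi_norm_le_iff_of_nonneg (by positivity)).2 fun j => ?_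
  have hj : |z j| ≤ D / N (Pi.single j (1 : ℝ)) := by
    rw [le_div_iff₀ (hN.single_pos j)]
    rcases hor j with h | h
    · exact (mul_le_mul_of_nonneg_right h (apply_nonneg _ _)).trans
        ((hN.abs_mul_single_le a j).trans hNa)
    · exact (mul_le_mul_of_nonneg_right h (apply_nonneg _ _)).trans
        ((hN.abs_mul_single_le c j).trans hNc)
  have := Finset.single_le_sum (fun i _ => hc i) (Finset.mem_univ j)
  rw [Real.norm_eq_abs]
  linarith

theorem dilation_pos {b : ℝ} (hb : 0 < b) (j : Fin k) : 0 < dilation V γ₁ γ₂ b j :=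
  Real.rpow_pos_of_pos hb _

theorem norm_dilation_mul_le (h₁ : 0 < γ₁) (h₁' : γ₁ ≤ 1) (h₂ : 0 < γ₂) (h₂' : γ₂ ≤ 1) {b : ℝ}
    (hb : 0 < b) (hb1 : b ≤ 1) (z : Fin k → ℝ) : ‖dilation V γ₁ γ₂ b * z‖ ≤ b * ‖z‖ := by
  refine (pi_norm_le_iff_of_nonneg (by positivity)).2 fun j => ?_
  rw [Pi.mul_apply, norm_mul, Real.norm_eq_abs, abs_of_pos (dilation_pos hb j)]
  refine mul_le_mul ?_ (norm_le_pi_norm z j) (norm_nonneg _) hb.le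
  have h : (1 : ℝ) ≤ if j ∈ V then 1 / γ₁ else 1 / γ₂ := by
    split_ifs
    · exact (one_le_div h₁).2 h₁'
    · exact (one_le_div h₂).2 h₂'
  calc _ ≤ b ^ (1 : ℝ) := Real.rpow_le_rpow_of_exponent_ge hb hb1 h
    _ = b := Real.rpow_one b

theorem rpow_scaleRatio_mem (h₂ : 0 < γ₂) (hγ : γ₂ ≤ γ₁) {b : ℝ} (hb : 0 < b) (hb1 : b ≤ 1) :
    0 < b ^ (1 / γ₂ - 1 / γ₁) ∧ b ^ (1 / γ₂ - 1 / γ₁) ≤ 1 :=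
  ⟨Real.rpow_pos_of_pos hb _, Real.rpow_le_one hb.le hb1
    (sub_nonneg.2 (one_div_le_one_div_of_le h₂ hγ))⟩

theorem exists_norm_le_of_profile_pos (hN : IsMonotoneNorm N) (h₂ : 0 < γ₂) (hγ : γ₂ ≤ γ₁)
    (h₁ : γ₁ ≤ 1) (hC₁ : 0 < C₁) (hC₂ : 0 < C₂) : ∃ R : ℝ, 0 < R ∧ ∀ b : ℝ, 0 < b → b ≤ 1 →
      ∀ x : Fin k → ℝ, 0 < profile N V γ₁ C₁ γ₂ C₂ b x → ‖x‖ ≤ b * R := by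
  have h₁0 := h₂.trans_le hγ
  obtain ⟨R, hR, h⟩ := exists_norm_le_of_scaledProfile_pos (V := V) hN h₁0 h₂ hC₁ hC₂
  refine ⟨R, hR, fun b hb hb1 x hx => ?_⟩
  have hd : x = dilation V γ₁ γ₂ b * fun j => x j / dilation V γ₁ γ₂ b j := by
    ext j
    simp only [Pi.mul_apply]
    rw [mul_div_cancel₀ _ (dilation_pos hb j).ne']
  rw [hd] at hx ⊢
  rw [profile_dilation h₁0 h₂ hb] at hx
  have hs := rpow_scaleRatio_mem h₂ hγ hb hb1
  refine (norm_dilation_mul_le h₁0 h₁ h₂ (hγ.trans h₁) hb hb1 _).trans ?_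
  exact mul_le_mul_of_nonneg_left (h _ hs.1 hs.2 _ (pos_of_mul_pos_right hx hb.le)) hb.le

/-- The least favorable pair: `f` follows its upper envelope until it reaches height `b`, and `g`
follows its lower envelope from `b` until it meets `f`, then coincides with it. For `g` to lie in
the rougher class `f` must too; truncation at `b ≤ C₂` bounds its oscillation and ensures this. -/
theorem exists_sub_eq_profile (hN : IsMonotoneNorm N) (S : Set (Fin k → ℝ)) (h₂ : 0 < γ₂)
    (hγ : γ₂ ≤ γ₁) (h₁ : γ₁ ≤ 1) (hC₁ : 0 < C₁) (hC : C₁ ≤ C₂) {b : ℝ} (hb : 0 ≤ b)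
    (hbC : b ≤ C₂) : ∃ f ∈ monotoneHolderClass N S V γ₁ C₁, ∃ g ∈ monotoneHolderClass N S V γ₂ C₂,
      (∀ x, g x - f x = profile N V γ₁ C₁ γ₂ C₂ b x) ∧ g 0 - f 0 = b := by
  have h₁0 := h₂.trans_le hγ
  have hC₂ := hC₁.trans_le hC
  set f : (Fin k → ℝ) → ℝ := fun x => min (C₁ * N (posPartOn V x) ^ γ₁) b with hfdef
  set g : (Fin k → ℝ) → ℝ := fun x => max (b + -(C₂ * N (posPartOn V (-x)) ^ γ₂)) (f x) with hgdef
  have hf : f ∈ monotoneHolderClass N S V γ₁ C₁ := min_mem_monotoneHolderClass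
    (posPartOn_mem_monotoneHolderClass hN h₁0.le h₁ hC₁.le)
    (const_mem_monotoneHolderClass hC₁.le b)
  have hf0 : ∀ x, 0 ≤ f x := fun x =>
    le_min (mul_nonneg hC₁.le (Real.rpow_nonneg (apply_nonneg _ _) _)) hb
  have hfb : ∀ x, f x ≤ b := fun x => min_le_right _ _
  have hf' : f ∈ monotoneHolderClass N S V γ₂ C₂ :=
    mem_monotoneHolderClass_of_osc_le h₂ hγ hC₁.le hC hf fun x z =>
      abs_le.2 ⟨by linarith [hf0 x, hfb z], by linarith [hf0 z, hfb x]⟩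
  have hg : g ∈ monotoneHolderClass N S V γ₂ C₂ := by
    refine max_mem_monotoneHolderClass (const_add_mem_monotoneHolderClass ?_ b) hf'
    have := reflect_mem_monotoneHolderClass (posPartOn_mem_monotoneHolderClass (S := -S) (V := V)
      hN h₂.le (hγ.trans h₁) hC₂.le)
    rwa [neg_neg] at this
  have hsub : ∀ x, g x - f x = profile N V γ₁ C₁ γ₂ C₂ b x := by
    intro x
    have hn := mul_nonneg hC₂.le (Real.rpow_nonneg (apply_nonneg N (posPartOn V (-x))) γ₂)
    simp only [hgdef, profile, negPartOn, hfdef]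
    rw [← max_sub_sub_right, sub_self]
    rcases le_total (C₁ * N (posPartOn V x) ^ γ₁) b with h | h
    · rw [min_eq_left h]
      congr 1
      ring
    -- Where `f` has saturated at `b`, both sides vanish.
    · rw [min_eq_right h, max_eq_right (by linarith), max_eq_right (by linarith)]
  refine ⟨f, hf, g, hg, hsub, ?_⟩
  rw [hsub]
  simp [profile, negPartOn, posPartOn_zero, Real.zero_rpow h₁0.ne', Real.zero_rpow h₂.ne', hb]

/-- The profile is supported within radius `b * R`, so for small `b` its support lies in a ball
contained in `S`, where both envelopes apply. Elsewhere it is zero and nothing is required. -/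
theorem exists_forall_profile_le_abs_sub (hN : IsMonotoneNorm N) {S : Set (Fin k → ℝ)}
    (hS : S ∈ 𝓝 0) (h₂ : 0 < γ₂) (hγ : γ₂ ≤ γ₁) (h₁ : γ₁ ≤ 1) (hC₁ : 0 < C₁) (hC₂ : 0 < C₂) :
    ∃ b₀ : ℝ, 0 < b₀ ∧ ∀ b : ℝ, 0 < b → b < b₀ → ∀ f ∈ monotoneHolderClass N S V γ₁ C₁,
      ∀ g ∈ monotoneHolderClass N S V γ₂ C₂, b ≤ g 0 - f 0 →
        ∀ x, profile N V γ₁ C₁ γ₂ C₂ b x ≤ |g x - f x| := by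
  obtain ⟨ρ, hρ, hball⟩ := Metric.mem_nhds_iff.1 hS
  obtain ⟨R, hR, hloc⟩ := exists_norm_le_of_profile_pos (V := V) hN h₂ hγ h₁ hC₁ hC₂
  refine ⟨min 1 (ρ / R), lt_min one_pos (by positivity), fun b hb hb0 f hf g hg hgap x => ?_⟩
  rcases (profile_nonneg (N := N) (V := V) (γ₁ := γ₁) (C₁ := C₁) (γ₂ := γ₂) (C₂ := C₂)
    b x).eq_or_lt with h | h
  · rw [← h]; exact abs_nonneg _
  have hx : ‖x‖ < ρ := (hloc b hb (hb0.trans_le (min_le_left _ _)).le x h).trans_lt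
    ((lt_div_iff₀ hR).1 (hb0.trans_le (min_le_right _ _)))
  have hfx := le_add_of_mem_monotoneHolderClass hf hball hx
  have hgx := le_of_mem_monotoneHolderClass hg hball hx
  exact max_le (le_trans (by linarith) (le_abs_self _)) (abs_nonneg _)

end Profile

/-! ### The limiting constant: scaling, convergence and positivity -/

section Constant

variable {k : ℕ} {N : Seminorm ℝ (Fin k → ℝ)} {V : Finset (Fin k)} {γ₁ C₁ γ₂ C₂ : ℝ}

theorem rateExponent_pos (h₁ : 0 < γ₁) (h₂ : 0 < γ₂) : 0 < rateExponent V γ₁ γ₂ := by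
  have hV : (V.card : ℝ) ≤ k := by
    exact_mod_cast (Finset.card_le_univ V).trans_eq (Fintype.card_fin k)
  have h1 : 0 ≤ (V.card : ℝ) / γ₁ := by positivity
  have h2 : 0 ≤ ((k : ℝ) - V.card) / γ₂ := div_nonneg (sub_nonneg.2 hV) h₂.le
  exact inv_pos.2 (by linarith)

theorem prod_dilation {b : ℝ} (hb : 0 < b) :
    ∏ j, dilation V γ₁ γ₂ b j = b ^ ((V.card : ℝ) / γ₁ + ((k : ℝ) - V.card) / γ₂) := by
  unfold dilation
  rw [← Real.rpow_sum_of_pos hb, Finset.sum_ite]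
  congr 1
  have h : ((Finset.univ.filter fun j => j ∉ V).card : ℝ) = (k : ℝ) - V.card := by
    rw [Finset.filter_not, Finset.filter_mem_eq_inter, Finset.univ_inter,
      Finset.cast_card_sdiff (Finset.subset_univ V)]
    simp
  rw [Finset.sum_const, Finset.sum_const, nsmul_eq_mul, nsmul_eq_mul, h]
  simp [div_eq_mul_inv]

theorem integral_eq_prod_mul_integral_mul {D : Fin k → ℝ} (hD : ∀ j, 0 < D j)
    (F : (Fin k → ℝ) → ℝ) : ∫ x, F x = (∏ j, D j) * ∫ z, F (D * z) := by
  classical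
  have hdet : (Matrix.diagonal D).det = ∏ j, D j := Matrix.det_diagonal
  have hpos : 0 < ∏ j, D j := Finset.prod_pos fun j _ => hD j
  have hv := Real.smul_map_diagonal_volume_pi (D := D) (by rw [hdet]; exact hpos.ne')
  have hme : MeasurableEmbedding (Matrix.toLin' (Matrix.diagonal D)) := by
    have h : Function.Injective (Matrix.toLin' (Matrix.diagonal D)) := fun x y hxy => by
      ext j
      have := congrFun hxy j
      simp only [Matrix.toLin'_apply, Matrix.mulVec_diagonal] at this
      exact mul_left_cancel₀ (hD j).ne' this
    exact (LinearMap.continuous_of_finiteDimensional _).measurableEmbedding h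
  conv_lhs => rw [← hv]
  rw [integral_smul_measure, hme.integral_map, hdet, ENNReal.toReal_ofReal (abs_nonneg _),
    abs_of_pos hpos, smul_eq_mul]
  congr 1
  refine integral_congr_ae (ae_of_all _ fun z => congrArg F ?_)
  ext j
  simp [Matrix.toLin'_apply, Matrix.mulVec_diagonal]

/-- The limit of `scaledProfile` as the ratio of the scales tends to its limiting value. -/
noncomputable def limitProfile (N : Seminorm ℝ (Fin k → ℝ)) (V : Finset (Fin k))
    (γ₁ C₁ γ₂ C₂ : ℝ) : (Fin k → ℝ) → ℝ :=
  if γ₂ < γ₁ then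
    Set.indicator {z : Fin k → ℝ | ∀ j ∈ V, 0 ≤ z j}
      fun z => max (1 - C₁ * N (restrictTo V z) ^ γ₁ - C₂ * N (restrictTo Vᶜ z) ^ γ₂) 0
  else
    fun z => max (1 - C₁ * N (posPartOn V z) ^ γ₁ - C₂ * N (negPartOn V z) ^ γ₂) 0

theorem measurableSet_nonneg_on :
    MeasurableSet {z : Fin k → ℝ | ∀ j ∈ V, 0 ≤ z j} := by
  have : {z : Fin k → ℝ | ∀ j ∈ V, 0 ≤ z j} = ⋂ j ∈ V, {z | 0 ≤ z j} := by
    ext z; simp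
  rw [this]
  exact Finset.measurableSet_biInter _ fun j _ =>
    measurableSet_le measurable_const (measurable_pi_apply j)

theorem kappa12_eq_integral : kappa12 N V γ₁ C₁ γ₂ C₂ =
    ∫ z, limitProfile N V γ₁ C₁ γ₂ C₂ z ^ 2 := by
  unfold kappa12 limitProfile
  split_ifs
  · rw [← integral_indicator measurableSet_nonneg_on]
    refine integral_congr_ae (ae_of_all _ fun z => ?_)
    simp [Set.indicator]
  · rfl

theorem restrictTo_neg (z : Fin k → ℝ) : restrictTo V (-z) = -restrictTo V z := by
  ext j
  by_cases hj : j ∈ V <;> simp [restrictTo, hj]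

/-- Substitute `z ↦ -z`, which exchanges positive and negative parts and the two orthant conditions.
-/
theorem kappa21_eq_kappa12 : kappa21 N V γ₁ C₁ γ₂ C₂ = kappa12 N V γ₁ C₁ γ₂ C₂ := by
  unfold kappa21 kappa12
  split_ifs
  · have hm : MeasurableSet {z : Fin k → ℝ | ∀ j ∈ V, z j ≤ 0} := by
      have := (measurableSet_nonneg_on (V := V)).preimage (measurable_neg (G := Fin k → ℝ))
      simpa using this
    rw [← integral_indicator measurableSet_nonneg_on, ← integral_indicator hm,
      ← integral_neg_eq_self]
    refine integral_congr_ae (ae_of_all _ fun z => ?_)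
    simp only [Set.indicator, Set.mem_ofPred_eq, Pi.neg_apply, neg_nonpos, restrictTo_neg,
      map_neg_eq_map]
    split_ifs
    · congr 2
      ring
    · rfl
  · rw [← integral_neg_eq_self]
    refine integral_congr_ae (ae_of_all _ fun z => ?_)
    simp only [negPartOn, neg_neg]
    congr 2
    ring

/-- For equal exponents the scale ratio is constantly `1`. Otherwise it tends to `0`: if `z` is
nonnegative on `V` the expression extends continuously to ratio `0`, while a negative `V`-coordinate
makes the second penalty blow up and the profile eventually vanish. -/
theorem tendsto_scaledProfile (hN : IsMonotoneNorm N) (h₂ : 0 < γ₂) (hγ : γ₂ ≤ γ₁)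
    (hC₂ : 0 < C₂) (z : Fin k → ℝ) :
    Tendsto (fun b : ℝ => scaledProfile N V γ₁ C₁ γ₂ C₂ (b ^ (1 / γ₂ - 1 / γ₁)) z) (𝓝[>] 0)
      (𝓝 (limitProfile N V γ₁ C₁ γ₂ C₂ z)) := by
  have h₁ := h₂.trans_le hγ
  rcases hγ.eq_or_lt with rfl | hlt
  · have : ∀ b : ℝ, scaledProfile N V γ₂ C₁ γ₂ C₂ (b ^ (1 / γ₂ - 1 / γ₂)) z =
        limitProfile N V γ₂ C₁ γ₂ C₂ z := fun b => by
      simp only [sub_self, Real.rpow_zero, scaledProfile, limitProfile, lt_irrefl, if_false,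
        one_mul, inv_one]
      rfl
    simp only [this, tendsto_const_nhds]
  have hρ : 0 < 1 / γ₂ - 1 / γ₁ := sub_pos.2 (one_div_lt_one_div_of_lt h₂ hlt)
  have hs0 : Tendsto (fun b : ℝ => b ^ (1 / γ₂ - 1 / γ₁)) (𝓝[>] 0) (𝓝[>] 0) := by
    refine tendsto_nhdsWithin_iff.2 ⟨?_, ?_⟩
    · have := (Real.continuousAt_rpow_const 0 (1 / γ₂ - 1 / γ₁) (Or.inr hρ.le)).tendsto
      rw [Real.zero_rpow hρ.ne'] at this
      exact this.mono_left nhdsWithin_le_nhds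
    · filter_upwards [self_mem_nhdsWithin] with b hb
      exact Real.rpow_pos_of_pos hb _
  refine Tendsto.comp (g := fun s => scaledProfile N V γ₁ C₁ γ₂ C₂ s z) ?_ hs0
  by_cases hz : ∀ j ∈ V, 0 ≤ z j
  · have hcont : Continuous fun s : ℝ =>
        max (1 - C₁ * N (fun j => if j ∈ V then max (z j) 0 else s * z j) ^ γ₁ -
          C₂ * N (restrictTo Vᶜ z) ^ γ₂) 0 := by
      have h : Continuous fun s : ℝ => N (fun j => if j ∈ V then max (z j) 0 else s * z j) ^ γ₁ :=
        (hN.continuous.comp (continuous_pi fun j => by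
          split_ifs <;> fun_prop)).rpow_const fun _ => Or.inr h₁.le
      fun_prop
    have hlim : limitProfile N V γ₁ C₁ γ₂ C₂ z =
        max (1 - C₁ * N (fun j => if j ∈ V then max (z j) 0 else (0 : ℝ) * z j) ^ γ₁ -
          C₂ * N (restrictTo Vᶜ z) ^ γ₂) 0 := by
      simp only [limitProfile, hlt, if_true]
      rw [Set.indicator_of_mem (show z ∈ {z : Fin k → ℝ | ∀ j ∈ V, 0 ≤ z j} from hz)]
      have hr : restrictTo V z = fun j => if j ∈ V then max (z j) 0 else (0 : ℝ) * z j := by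
        ext j
        by_cases hj : j ∈ V
        · simp [restrictTo, hj, hz j hj]
        · simp [restrictTo, hj]
      rw [hr]
    rw [hlim]
    refine (hcont.tendsto 0).mono_left nhdsWithin_le_nhds |>.congr fun s => ?_
    unfold scaledProfile
    congr 4
    -- The second argument is now `-restrictTo Vᶜ z`, and a monotone norm ignores signs.
    refine hN.eq_of_abs_eq fun j => ?_
    by_cases hj : j ∈ V
    · simp [restrictTo, hj, hz j hj]
    · simp [restrictTo, hj]
  · have hlim : limitProfile N V γ₁ C₁ γ₂ C₂ z = 0 := by
      simp only [limitProfile, hlt, if_true]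
      exact Set.indicator_of_notMem
        (show z ∉ {z : Fin k → ℝ | ∀ j ∈ V, 0 ≤ z j} from hz) _
    rw [hlim]
    push Not at hz
    obtain ⟨j, hj, hzj⟩ := hz
    refine tendsto_const_nhds.congr' ?_
    set w : ℝ := -z j * N (Pi.single j (1 : ℝ)) with hw
    have hw0 : 0 < w := mul_pos (by linarith) (hN.single_pos j)
    have hC₁' : Tendsto (fun s : ℝ => C₂ * (s⁻¹ * w) ^ γ₂) (𝓝[>] 0) atTop :=
      ((tendsto_rpow_atTop h₂).comp (tendsto_inv_nhdsGT_zero.atTop_mul_const hw0)).const_mul_atTop hC₂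
    have hA : Tendsto (fun s : ℝ =>
        1 - C₁ * N (fun j => if j ∈ V then max (z j) 0 else s * z j) ^ γ₁) (𝓝[>] 0)
        (𝓝 (1 - C₁ * N (fun j => if j ∈ V then max (z j) 0 else (0 : ℝ) * z j) ^ γ₁)) := by
      have h : Continuous fun s : ℝ => N (fun j => if j ∈ V then max (z j) 0 else s * z j) ^ γ₁ :=
        (hN.continuous.comp (continuous_pi fun j => by
          split_ifs <;> fun_prop)).rpow_const fun _ => Or.inr h₁.le
      have h' : Continuous fun s : ℝ =>
        1 - C₁ * N (fun j => if j ∈ V then max (z j) 0 else s * z j) ^ γ₁ := by fun_prop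
      exact (h'.tendsto 0).mono_left nhdsWithin_le_nhds
    filter_upwards [hA.eventually (gt_mem_nhds (lt_add_one _)),
      hC₁'.eventually_ge_atTop
        (1 - C₁ * N (fun j => if j ∈ V then max (z j) 0 else (0 : ℝ) * z j) ^ γ₁ + 1),
      self_mem_nhdsWithin] with s hs1 hs2 hs3
    have hs3 : 0 < s := hs3
    have hle : s⁻¹ * w ≤ N (fun j => if j ∈ V then s⁻¹ * max (-z j) 0 else -z j) := by
      refine le_trans (le_of_eq ?_) (hN.abs_mul_single_le _ j)
      simp only [hj, if_true]
      rw [max_eq_left (by linarith), abs_of_pos (mul_pos (inv_pos.2 hs3) (by linarith)), hw,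
        mul_assoc]
    have hle' := mul_le_mul_of_nonneg_left
      (Real.rpow_le_rpow (mul_pos (inv_pos.2 hs3) hw0).le hle h₂.le) hC₂.le
    unfold scaledProfile
    exact (max_eq_right (by linarith)).symm

theorem measurable_limitProfile (hN : IsMonotoneNorm N) (h₁ : 0 ≤ γ₁) (h₂ : 0 ≤ γ₂) :
    Measurable (limitProfile N V γ₁ C₁ γ₂ C₂) := by
  unfold limitProfile
  split_ifs
  · refine Measurable.indicator ?_ measurableSet_nonneg_on
    have hr : ∀ W : Finset (Fin k), Continuous (restrictTo W) := fun W =>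
      continuous_pi fun j => by
        unfold restrictTo
        split_ifs <;> fun_prop
    have h1 : Continuous fun z => N (restrictTo V z) ^ γ₁ :=
      (hN.continuous.comp (hr V)).rpow_const fun _ => Or.inr h₁
    have h2 : Continuous fun z => N (restrictTo Vᶜ z) ^ γ₂ :=
      (hN.continuous.comp (hr Vᶜ)).rpow_const fun _ => Or.inr h₂
    refine Continuous.measurable ?_
    fun_prop
  · exact (continuous_profile hN h₁ h₂ 1).measurable

/-- Change variables by the dilation and use dominated convergence. The density is bounded by `p 0 +
1` only near `0`, which suffices because the dilated support shrinks to the origin. -/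
theorem tendsto_integral_profile (hN : IsMonotoneNorm N) (h₂ : 0 < γ₂) (hγ : γ₂ ≤ γ₁)
    (h₁ : γ₁ ≤ 1) (hC₁ : 0 < C₁) (hC₂ : 0 < C₂) {p : (Fin k → ℝ) → ℝ} (hp : Measurable p)
    (hp_nonneg : ∀ x, 0 ≤ p x) (hp_cont : ContinuousAt p 0) :
    Tendsto (fun b : ℝ => b ^ (-(rateExponent V γ₁ γ₂)⁻¹) *
      ∫ x, p x * profile N V γ₁ C₁ γ₂ C₂ b x ^ 2) (𝓝[>] 0)
      (𝓝 (p 0 * kappa12 N V γ₁ C₁ γ₂ C₂)) := by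
  have h₁0 := h₂.trans_le hγ
  have hscale : ∀ b : ℝ, 0 < b → b ^ (-(rateExponent V γ₁ γ₂)⁻¹) *
      ∫ x, p x * profile N V γ₁ C₁ γ₂ C₂ b x ^ 2 = ∫ z, p (dilation V γ₁ γ₂ b * z) *
        scaledProfile N V γ₁ C₁ γ₂ C₂ (b ^ (1 / γ₂ - 1 / γ₁)) z ^ 2 := by
    intro b hb
    rw [integral_eq_prod_mul_integral_mul (dilation_pos (V := V) (γ₁ := γ₁) (γ₂ := γ₂) hb),
      prod_dilation hb, ← mul_assoc, ← Real.rpow_add hb, ← integral_const_mul]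
    refine integral_congr_ae (ae_of_all _ fun z => ?_)
    simp only [profile_dilation h₁0 h₂ hb, rateExponent, inv_inv]
    -- The power `b ^ (-2)` that remains after the Jacobian cancels the squared height of the
    -- profile.
    have he : -(2 + (V.card : ℝ) / γ₁ + ((k : ℝ) - V.card) / γ₂) +
        ((V.card : ℝ) / γ₁ + ((k : ℝ) - V.card) / γ₂) = -(2 : ℝ) := by ring
    rw [he, Real.rpow_neg hb.le, Real.rpow_two]
    field_simp
  obtain ⟨R, hR, hloc⟩ := exists_norm_le_of_scaledProfile_pos (V := V) hN h₁0 h₂ hC₁ hC₂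
  rw [kappa12_eq_integral, ← integral_const_mul]
  refine Tendsto.congr' (f₁ := fun b : ℝ => ∫ z, p (dilation V γ₁ γ₂ b * z) *
        scaledProfile N V γ₁ C₁ γ₂ C₂ (b ^ (1 / γ₂ - 1 / γ₁)) z ^ 2) ?_ ?_
  · filter_upwards [self_mem_nhdsWithin] with b hb using (hscale b hb).symm
  obtain ⟨ρ, hρ, hpρ⟩ := Metric.mem_nhds_iff.1 (hp_cont.eventually (gt_mem_nhds (lt_add_one _)))
  have hone : ∀ᶠ b : ℝ in 𝓝[>] 0, 0 < b ∧ b ≤ 1 := by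
    filter_upwards [Ioc_mem_nhdsGT (zero_lt_one (α := ℝ))] with b hb using hb
  have hsmall : ∀ᶠ b : ℝ in 𝓝[>] 0, b * R < ρ := by
    filter_upwards [Ioo_mem_nhdsGT (div_pos hρ hR)] with b hb using (lt_div_iff₀ hR).1 hb.2
  refine tendsto_integral_filter_of_dominated_convergence
    (Set.indicator (Metric.closedBall 0 R) fun _ => p 0 + 1) ?_ ?_ ?_ ?_
  · filter_upwards [hone] with b hb
    have hd : Measurable fun z : Fin k → ℝ => dilation V γ₁ γ₂ b * z := by fun_prop
    have hm : Measurable fun z => b * scaledProfile N V γ₁ C₁ γ₂ C₂ (b ^ (1 / γ₂ - 1 / γ₁)) z := by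
      simp only [← profile_dilation h₁0 h₂ hb.1]
      exact (continuous_profile hN h₁0.le h₂.le b).measurable.comp hd
    have hm' : Measurable (scaledProfile N V γ₁ C₁ γ₂ C₂ (b ^ (1 / γ₂ - 1 / γ₁))) := by
      have := hm.const_mul b⁻¹
      simpa only [inv_mul_cancel_left₀ hb.1.ne'] using this
    exact ((hp.comp hd).mul (hm'.pow_const 2)).aestronglyMeasurable
  · filter_upwards [hone, hsmall] with b hb hbR
    refine ae_of_all _ fun z => ?_
    have hs := rpow_scaleRatio_mem h₂ hγ hb.1 hb.2
    have h0 := scaledProfile_nonneg (N := N) (V := V) (γ₁ := γ₁) (C₁ := C₁) (γ₂ := γ₂) (C₂ := C₂)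
      (b ^ (1 / γ₂ - 1 / γ₁)) z
    have h1 := scaledProfile_le_one (N := N) (V := V) (γ₁ := γ₁) (γ₂ := γ₂) hC₁.le hC₂.le
      (b ^ (1 / γ₂ - 1 / γ₁)) z
    rw [Real.norm_eq_abs, abs_of_nonneg (mul_nonneg (hp_nonneg _) (sq_nonneg _))]
    rcases h0.eq_or_lt with h | h
    · rw [← h]
      simp only [ne_eq, OfNat.ofNat_ne_zero, not_false_eq_true, zero_pow, mul_zero]
      exact Set.indicator_nonneg (fun _ _ => by linarith [hp_nonneg 0]) _
    · have hz := hloc _ hs.1 hs.2 z h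
      rw [Set.indicator_of_mem (by simpa using hz)]
      have hlt : p (dilation V γ₁ γ₂ b * z) < p 0 + 1 := hpρ (by
        rw [mem_ball_zero_iff]
        exact ((norm_dilation_mul_le h₁0 h₁ h₂ (hγ.trans h₁) hb.1 hb.2 z).trans
          (mul_le_mul_of_nonneg_left hz hb.1.le)).trans_lt hbR)
      calc _ ≤ (p 0 + 1) * 1 := mul_le_mul hlt.le (pow_le_one₀ h0 h1) (sq_nonneg _)
            (by linarith [hp_nonneg 0])
        _ = _ := mul_one _
  · rw [integrable_indicator_iff Metric.isClosed_closedBall.measurableSet]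
    exact integrableOn_const (measure_closedBall_lt_top).ne
  · refine ae_of_all _ fun z => ?_
    have hd : Tendsto (fun b : ℝ => dilation V γ₁ γ₂ b * z) (𝓝[>] 0) (𝓝 0) := by
      refine squeeze_zero_norm' (a := fun b : ℝ => b * ‖z‖) ?_ ?_
      · filter_upwards [hone] with b hb
        exact norm_dilation_mul_le h₁0 h₁ h₂ (hγ.trans h₁) hb.1 hb.2 z
      · have : Continuous fun b : ℝ => b * ‖z‖ := by fun_prop
        have := this.tendsto 0
        rw [zero_mul] at this
        exact this.mono_left nhdsWithin_le_nhds
    exact (hp_cont.tendsto.comp hd).mul ((tendsto_scaledProfile hN h₂ hγ hC₂ z).pow 2)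

/-- On a small open cube with all coordinates positive, the orthant restriction is satisfied and
both penalties are at most their values at `z` itself, which are small. -/
theorem kappa12_pos (hN : IsMonotoneNorm N) (h₂ : 0 < γ₂) (hγ : γ₂ ≤ γ₁)
    (hC₁ : 0 < C₁) (hC₂ : 0 < C₂) : 0 < kappa12 N V γ₁ C₁ γ₂ C₂ := by
  have h₁ := h₂.trans_le hγ
  have hone : ∀ᶠ b : ℝ in 𝓝[>] 0, 0 < b ∧ b ≤ 1 := by
    filter_upwards [Ioc_mem_nhdsGT (zero_lt_one (α := ℝ))] with b hb using hb
  obtain ⟨R, hR, hloc⟩ := exists_norm_le_of_scaledProfile_pos (V := V) hN h₁ h₂ hC₁ hC₂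
  have hnn : ∀ z, 0 ≤ limitProfile N V γ₁ C₁ γ₂ C₂ z := fun z =>
    ge_of_tendsto' (tendsto_scaledProfile hN h₂ hγ hC₂ z) fun b => scaledProfile_nonneg _ _
  have hle : ∀ z, limitProfile N V γ₁ C₁ γ₂ C₂ z ≤ 1 := fun z =>
    le_of_tendsto' (tendsto_scaledProfile hN h₂ hγ hC₂ z) fun b =>
      scaledProfile_le_one hC₁.le hC₂.le _ _
  have hsupp : ∀ z, 0 < limitProfile N V γ₁ C₁ γ₂ C₂ z → ‖z‖ ≤ R := fun z hz => by
    obtain ⟨b, hb, hb'⟩ := (((tendsto_scaledProfile hN h₂ hγ hC₂ z).eventually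
      (lt_mem_nhds hz)).and hone).exists
    have hs := rpow_scaleRatio_mem h₂ hγ hb'.1 hb'.2
    exact hloc _ hs.1 hs.2 z hb
  have hint : Integrable fun z => limitProfile N V γ₁ C₁ γ₂ C₂ z ^ 2 := by
    have hI : Integrable (Set.indicator (Metric.closedBall (0 : Fin k → ℝ) R) fun _ => (1 : ℝ)) := by
      rw [integrable_indicator_iff Metric.isClosed_closedBall.measurableSet]
      exact integrableOn_const (measure_closedBall_lt_top).ne
    refine hI.mono' ((measurable_limitProfile hN h₁.le h₂.le).pow_const 2).aestronglyMeasurable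
      (ae_of_all _ fun z => ?_)
    rw [Real.norm_eq_abs, abs_of_nonneg (sq_nonneg _)]
    rcases (hnn z).eq_or_lt with h | h
    · rw [← h]
      simp only [ne_eq, OfNat.ofNat_ne_zero, not_false_eq_true, zero_pow]
      exact Set.indicator_nonneg (fun _ _ => zero_le_one) _
    · rw [Set.indicator_of_mem (by simpa using hsupp z h)]
      exact pow_le_one₀ (hnn z) (hle z)
  rw [kappa12_eq_integral, integral_pos_iff_support_of_nonneg (fun z => sq_nonneg _) hint]
  have hcont : Continuous fun z => 1 - C₁ * N z ^ γ₁ - C₂ * N z ^ γ₂ := by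
    have h1 : Continuous fun z => N z ^ γ₁ := hN.continuous.rpow_const fun _ => Or.inr h₁.le
    have h2 : Continuous fun z => N z ^ γ₂ := hN.continuous.rpow_const fun _ => Or.inr h₂.le
    fun_prop
  have hev : ∀ᶠ z in 𝓝 (0 : Fin k → ℝ), 0 < 1 - C₁ * N z ^ γ₁ - C₂ * N z ^ γ₂ := by
    refine hcont.continuousAt.eventually (lt_mem_nhds ?_)
    simp [Real.zero_rpow h₁.ne', Real.zero_rpow h₂.ne']
  obtain ⟨ε, hε, hball⟩ := Metric.mem_nhds_iff.1 hev
  have hopen : IsOpen (Set.pi Set.univ fun _ : Fin k => Set.Ioo (0 : ℝ) ε) :=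
    isOpen_set_pi Set.finite_univ fun _ _ => isOpen_Ioo
  have hne : (Set.pi Set.univ fun _ : Fin k => Set.Ioo (0 : ℝ) ε).Nonempty :=
    ⟨fun _ => ε / 2, fun _ _ => ⟨by positivity, by linarith⟩⟩
  refine (hopen.measure_pos volume hne).trans_le (measure_mono fun z hz => ?_)
  have hz' : ∀ j, 0 < z j ∧ z j < ε := fun j => hz j (Set.mem_univ j)
  have hval : 0 < 1 - C₁ * N z ^ γ₁ - C₂ * N z ^ γ₂ := by
    refine hball (mem_ball_zero_iff.2 ((pi_norm_lt_iff hε).2 fun j => ?_))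
    rw [Real.norm_eq_abs, abs_of_pos (hz' j).1]
    exact (hz' j).2
  have hmono : ∀ u v : Fin k → ℝ, (∀ j, |u j| ≤ |z j|) → (∀ j, |v j| ≤ |z j|) →
      0 < 1 - C₁ * N u ^ γ₁ - C₂ * N v ^ γ₂ := fun u v hu hv => by
    have h1 := mul_le_mul_of_nonneg_left
      (Real.rpow_le_rpow (apply_nonneg N u) (hN.2 _ _ hu) h₁.le) hC₁.le
    have h2 := mul_le_mul_of_nonneg_left
      (Real.rpow_le_rpow (apply_nonneg N v) (hN.2 _ _ hv) h₂.le) hC₂.le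
    linarith
  have hres : ∀ (W : Finset (Fin k)) (j : Fin k), |restrictTo W z j| ≤ |z j| := fun W j => by
    unfold restrictTo
    split_ifs <;> simp
  have hpos : 0 < limitProfile N V γ₁ C₁ γ₂ C₂ z := by
    unfold limitProfile
    split_ifs
    · rw [Set.indicator_of_mem (show z ∈ {z : Fin k → ℝ | ∀ j ∈ V, 0 ≤ z j} from
        fun j _ => (hz' j).1.le)]
      exact lt_max_of_lt_left (hmono _ _ (hres V) (hres Vᶜ))
    · refine lt_max_of_lt_left (hmono _ _ (abs_posPartOn_le z) fun j => ?_)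
      simpa [negPartOn] using abs_posPartOn_le (V := V) (-z) j
  exact (pow_pos hpos 2).ne'

end Constant

/-! ### From profile sums to the moduli, for a fixed design -/

section Modulus

variable {k : ℕ}

/-- The set of gaps at the origin over which `orderedModulus` takes the supremum when `σ = 1`. -/
def gapSet (x : ℕ → Fin k → ℝ) (n : ℕ) (δ : ℝ) (F G : Set ((Fin k → ℝ) → ℝ)) : Set ℝ :=
  {t : ℝ | ∃ f ∈ F, ∃ g ∈ G, ∑ i ∈ Finset.range n, (g (x i) - f (x i)) ^ 2 ≤ δ ^ 2 ∧
    t = g 0 - f 0}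

theorem orderedModulus_one (x : ℕ → Fin k → ℝ) (n : ℕ) (δ : ℝ) (F G : Set ((Fin k → ℝ) → ℝ)) :
    orderedModulus (fun _ => 1) x n δ F G = sSup (gapSet x n δ F G) := by
  simp only [orderedModulus, gapSet, div_one]

/-- Boundedness is essential: the real `sSup` of an unbounded set is `0`, which would break the
comparison of suprema. -/
theorem betweenModulus_one {x : ℕ → Fin k → ℝ} {n : ℕ} {δ : ℝ} {F G : Set ((Fin k → ℝ) → ℝ)}
    (h : (gapSet x n δ F G).Nonempty) (hFG : BddAbove (gapSet x n δ F G))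
    (hGF : BddAbove (gapSet x n δ G F)) :
    betweenModulus (fun _ => 1) x n δ F G =
      max (sSup (gapSet x n δ F G)) (sSup (gapSet x n δ G F)) := by
  have hswap : ∀ f g : (Fin k → ℝ) → ℝ, ∑ i ∈ Finset.range n, (g (x i) - f (x i)) ^ 2 =
      ∑ i ∈ Finset.range n, (f (x i) - g (x i)) ^ 2 := fun f g =>
    Finset.sum_congr rfl fun i _ => sub_sq_comm _ _
  simp only [betweenModulus, div_one]
  set B : Set ℝ := {t : ℝ | ∃ f ∈ F, ∃ g ∈ G,
    ∑ i ∈ Finset.range n, (g (x i) - f (x i)) ^ 2 ≤ δ ^ 2 ∧ t = |g 0 - f 0|} with hB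
  have hle : ∀ t ∈ B, t ≤ max (sSup (gapSet x n δ F G)) (sSup (gapSet x n δ G F)) := by
    rintro t ⟨f, hf, g, hg, hs, rfl⟩
    refine abs_le'.2 ⟨le_max_of_le_left (le_csSup hFG ⟨f, hf, g, hg, hs, rfl⟩),
      le_max_of_le_right (le_csSup hGF ⟨g, hg, f, hf, ?_, neg_sub _ _⟩)⟩
    rwa [hswap] at hs
  obtain ⟨t, f, hf, g, hg, hs, rfl⟩ := h
  refine le_antisymm (csSup_le ⟨_, f, hf, g, hg, hs, rfl⟩ hle) (max_le ?_ ?_)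
  · refine csSup_le ⟨_, f, hf, g, hg, hs, rfl⟩ ?_
    rintro t ⟨f, hf, g, hg, hs, rfl⟩
    exact (le_abs_self _).trans (le_csSup ⟨_, hle⟩ ⟨f, hf, g, hg, hs, rfl⟩)
  · refine csSup_le ⟨_, g, hg, f, hf, (hswap g f).trans_le hs, rfl⟩ ?_
    rintro t ⟨f, hf, g, hg, hs, rfl⟩
    refine (le_abs_self _).trans (le_csSup ⟨_, hle⟩ ⟨g, hg, f, hf, ?_, abs_sub_comm _ _⟩)
    rwa [hswap]

variable {N : Seminorm ℝ (Fin k → ℝ)} {V : Finset (Fin k)} {γ₁ C₁ γ₂ C₂ : ℝ}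
  {S : Set (Fin k → ℝ)}

/-- The reflection `f ↦ -f (-·)` reverses the order of the two classes. -/
theorem gapSet_swap (x : ℕ → Fin k → ℝ) (n : ℕ) (δ : ℝ) :
    gapSet x n δ (monotoneHolderClass N S V γ₂ C₂) (monotoneHolderClass N S V γ₁ C₁) =
      gapSet (fun i => -x i) n δ (monotoneHolderClass N (-S) V γ₁ C₁)
        (monotoneHolderClass N (-S) V γ₂ C₂) := by
  have key : ∀ (x : ℕ → Fin k → ℝ) (S : Set (Fin k → ℝ)) (γ₁ C₁ γ₂ C₂ : ℝ),
      gapSet x n δ (monotoneHolderClass N S V γ₂ C₂) (monotoneHolderClass N S V γ₁ C₁) ⊆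
      gapSet (fun i => -x i) n δ (monotoneHolderClass N (-S) V γ₁ C₁)
        (monotoneHolderClass N (-S) V γ₂ C₂) := by
    rintro x S γ₁ C₁ γ₂ C₂ t ⟨f, hf, g, hg, hs, rfl⟩
    refine ⟨_, reflect_mem_monotoneHolderClass hg, _, reflect_mem_monotoneHolderClass hf, ?_, ?_⟩
    · simpa only [neg_neg, neg_sub_neg] using hs
    · simp only [neg_zero, neg_sub_neg]
  refine (key x S γ₁ C₁ γ₂ C₂).antisymm ?_
  simpa only [neg_neg] using key (fun i => -x i) (-S) γ₂ C₂ γ₁ C₁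

/-- A deterministic sandwich. If `c` is above the critical value, the profile with gap `c * n ^
(-r)` eventually costs more than `δ ^ 2`, so no admissible pair has a larger gap; below it, the
extremal pair is admissible. Rational `c` suffice by density. -/
theorem tendsto_orderedModulus (hN : IsMonotoneNorm N) (hS : S ∈ 𝓝 0) (h₂ : 0 < γ₂)
    (hγ : γ₂ ≤ γ₁) (h₁ : γ₁ ≤ 1) (hC₁ : 0 < C₁) (hC : C₁ ≤ C₂) {A r δ : ℝ} (hA : 0 < A)
    (hr : 0 < r) (hδ : 0 < δ) {x : ℕ → Fin k → ℝ}
    (hx : ∀ c : ℚ, 0 < c → Tendsto (fun n : ℕ => ∑ i ∈ Finset.range n,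
      profile N V γ₁ C₁ γ₂ C₂ (c * (n : ℝ) ^ (-r)) (x i) ^ 2) atTop (𝓝 (A * (c : ℝ) ^ r⁻¹))) :
    (∀ n, (gapSet x n δ (monotoneHolderClass N S V γ₁ C₁)
      (monotoneHolderClass N S V γ₂ C₂)).Nonempty) ∧
    (∀ᶠ n in atTop, BddAbove (gapSet x n δ (monotoneHolderClass N S V γ₁ C₁)
      (monotoneHolderClass N S V γ₂ C₂))) ∧
    Tendsto (fun n : ℕ => (n : ℝ) ^ r * sSup (gapSet x n δ (monotoneHolderClass N S V γ₁ C₁)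
      (monotoneHolderClass N S V γ₂ C₂))) atTop (𝓝 ((δ ^ 2 / A) ^ r)) := by
  have hC₂ := hC₁.trans_le hC
  set T : ℕ → Set ℝ := fun n => gapSet x n δ (monotoneHolderClass N S V γ₁ C₁)
      (monotoneHolderClass N S V γ₂ C₂) with hT
  have hne : ∀ n, (T n).Nonempty := fun n =>
    ⟨0, _, const_mem_monotoneHolderClass hC₁.le 0, _, const_mem_monotoneHolderClass hC₂.le 0,
      by simp [sq_nonneg], by simp⟩
  have hpos : ∀ᶠ n : ℕ in atTop, (0 : ℝ) < n :=
    (eventually_gt_atTop 0).mono fun n hn => Nat.cast_pos.2 hn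
  have hdecay : ∀ c : ℝ, Tendsto (fun n : ℕ => c * (n : ℝ) ^ (-r)) atTop (𝓝 0) := fun c => by
    have := ((tendsto_rpow_neg_atTop hr).comp tendsto_natCast_atTop_atTop).const_mul c
    rwa [mul_zero] at this
  obtain ⟨b₀, hb₀, hub⟩ := exists_forall_profile_le_abs_sub (V := V) hN hS h₂ hγ h₁ hC₁ hC₂
  -- The critical `c₀` solves `A * c ^ r⁻¹ = δ ^ 2`.
  set c₀ : ℝ := (δ ^ 2 / A) ^ r with hc₀
  have hc₀pos : 0 < c₀ := by positivity
  have hc₀' : A * c₀ ^ r⁻¹ = δ ^ 2 := by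
    rw [hc₀, ← Real.rpow_mul (by positivity), mul_inv_cancel₀ hr.ne', Real.rpow_one,
      mul_div_cancel₀ _ hA.ne']
  have hupper : ∀ c : ℚ, c₀ < c → ∀ᶠ n : ℕ in atTop, ∀ t ∈ T n, t ≤ c * (n : ℝ) ^ (-r) := by
    intro c hc
    have hc0 : (0 : ℝ) < c := hc₀pos.trans hc
    have hlt : δ ^ 2 < A * (c : ℝ) ^ r⁻¹ := by
      rw [← hc₀']
      exact mul_lt_mul_of_pos_left (Real.rpow_lt_rpow hc₀pos.le hc (inv_pos.2 hr)) hA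
    filter_upwards [(hx c (by exact_mod_cast hc0)).eventually (lt_mem_nhds hlt), hpos,
      (hdecay c).eventually (gt_mem_nhds hb₀)] with n hn hn0 hnb
    rintro t ⟨f, hf, g, hg, hs, rfl⟩
    by_contra! hgt
    have hb := hub _ (mul_pos hc0 (Real.rpow_pos_of_pos hn0 _)) hnb f hf g hg hgt.le
    refine absurd (hn.trans_le (le_trans (Finset.sum_le_sum fun i _ => ?_) hs)) (lt_irrefl _)
    rw [← sq_abs (g (x i) - f (x i))]
    exact pow_le_pow_left₀ (profile_nonneg _ _) (hb (x i)) 2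
  have hlower : ∀ c : ℚ, 0 < c → (c : ℝ) < c₀ → ∀ᶠ n : ℕ in atTop, c * (n : ℝ) ^ (-r) ∈ T n := by
    intro c hc0 hc
    have hc0' : (0 : ℝ) < c := by exact_mod_cast hc0
    have hlt : A * (c : ℝ) ^ r⁻¹ < δ ^ 2 := by
      rw [← hc₀']
      exact mul_lt_mul_of_pos_left (Real.rpow_lt_rpow hc0'.le hc (inv_pos.2 hr)) hA
    filter_upwards [(hx c hc0).eventually (gt_mem_nhds hlt), hpos,
      (hdecay c).eventually (gt_mem_nhds hC₂)] with n hn hn0 hnb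
    obtain ⟨f, hf, g, hg, hsub, hgap⟩ := exists_sub_eq_profile (V := V) hN S h₂ hγ h₁ hC₁ hC
      (mul_pos hc0' (Real.rpow_pos_of_pos hn0 (-r))).le hnb.le
    refine ⟨f, hf, g, hg, ?_, hgap.symm⟩
    simpa only [hsub] using hn.le
  have hcancel : ∀ (c : ℝ) (n : ℕ), (0 : ℝ) < n → (n : ℝ) ^ r * (c * (n : ℝ) ^ (-r)) = c := by
    intro c n hn
    rw [mul_left_comm, ← Real.rpow_add hn, add_neg_cancel, Real.rpow_zero, mul_one]
  have hbdd : ∀ᶠ n in atTop, BddAbove (T n) := by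
    obtain ⟨c, hc⟩ := exists_rat_gt c₀
    exact (hupper c hc).mono fun n hn => ⟨_, hn⟩
  refine ⟨hne, hbdd, tendsto_order.2 ⟨fun a ha => ?_, fun a ha => ?_⟩⟩
  · obtain ⟨c, hc1, hc2⟩ := exists_rat_btwn (max_lt ha hc₀pos)
    have hc0 : (0 : ℝ) < c := (le_max_right _ _).trans_lt hc1
    filter_upwards [hlower c (by exact_mod_cast hc0) hc2, hbdd, hpos] with n hn hb hn0
    calc a < c := (le_max_left _ _).trans_lt hc1
      _ = (n : ℝ) ^ r * (c * (n : ℝ) ^ (-r)) := (hcancel c n hn0).symm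
      _ ≤ _ := mul_le_mul_of_nonneg_left (le_csSup hb hn) (Real.rpow_nonneg hn0.le _)
  · obtain ⟨c, hc1, hc2⟩ := exists_rat_btwn ha
    filter_upwards [hupper c hc1, hpos] with n hn hn0
    calc _ ≤ (n : ℝ) ^ r * (c * (n : ℝ) ^ (-r)) :=
          mul_le_mul_of_nonneg_left (csSup_le (hne n) hn) (Real.rpow_nonneg hn0.le _)
      _ = c := hcancel c n hn0
      _ < a := hc2

end Modulus

/-! ### Random design: almost sure limits of the profile sums -/

section Design

variable {k : ℕ} {N : Seminorm ℝ (Fin k → ℝ)} {V : Finset (Fin k)} {γ₁ C₁ γ₂ C₂ : ℝ}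
  {Ω : Type*} [MeasurableSpace Ω] {P : Measure Ω}
  {X : ℕ → Ω → Fin k → ℝ} {p : (Fin k → ℝ) → ℝ}

theorem ae_tendsto_sum_profile [IsProbabilityMeasure P] (hN : IsMonotoneNorm N) (h₂ : 0 < γ₂)
    (hγ : γ₂ ≤ γ₁) (h₁ : γ₁ ≤ 1) (hC₁ : 0 < C₁) (hC₂ : 0 < C₂) (hX : ∀ i, Measurable (X i))
    (hind : iIndepFun X P) (hp : Measurable p) (hp_nonneg : ∀ x, 0 ≤ p x)
    (hdens : ∀ i, P.map (X i) = volume.withDensity (fun x => ENNReal.ofReal (p x)))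
    (hp_cont : ContinuousAt p 0) {c : ℝ} (hc : 0 < c) :
    ∀ᵐ a ∂P, Tendsto (fun n : ℕ => ∑ i ∈ Finset.range n, profile N V γ₁ C₁ γ₂ C₂
      (c * (n : ℝ) ^ (-rateExponent V γ₁ γ₂)) (X i a) ^ 2) atTop
      (𝓝 (p 0 * kappa12 N V γ₁ C₁ γ₂ C₂ * c ^ (rateExponent V γ₁ γ₂)⁻¹)) := by
  have h₁0 := h₂.trans_le hγ
  set r := rateExponent V γ₁ γ₂ with hrdef
  have hr : 0 < r := rateExponent_pos h₁0 h₂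
  have hpos : ∀ᶠ n : ℕ in atTop, (0 : ℝ) < n :=
    (eventually_gt_atTop 0).mono fun n hn => Nat.cast_pos.2 hn
  -- The summands are at most `b ^ 2`, of order `n ^ (-2 * r)`, so the strong law's summability
  -- condition is met by stretched exponentials.
  have hbnn : ∀ n : ℕ, 0 ≤ c * (n : ℝ) ^ (-r) := fun n => by positivity
  have hsq : ∀ n : ℕ, (c * (n : ℝ) ^ (-r)) ^ 2 = c ^ 2 * (n : ℝ) ^ (-(2 * r)) := fun n => by
    rw [mul_pow, ← Real.rpow_mul_natCast (Nat.cast_nonneg _)]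
    congr 2
    push_cast
    ring
  refine ae_tendsto_rowSum hX hind hdens (B := fun n : ℕ => (c * (n : ℝ) ^ (-r)) ^ 2)
    (fun n => ((continuous_profile hN h₁0.le h₂.le _).pow 2).measurable)
    (fun n x => sq_nonneg _)
    (fun n x => pow_le_pow_left₀ (profile_nonneg _ _) (profile_le hC₁.le hC₂.le (hbnn n) x) 2)
    (hpos.mono fun n hn => by positivity) (fun η hη => ?_) ?_
  · have := summable_exp_neg_div_rpow (c := η / c ^ 2) (s := 2 * r) (by positivity) (by positivity)
    simpa only [hsq, div_div] using this
  · have hlim : Tendsto (fun n : ℕ => c * (n : ℝ) ^ (-r)) atTop (𝓝[>] 0) := by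
      refine tendsto_nhdsWithin_iff.2 ⟨?_, hpos.mono fun n hn => ?_⟩
      · have := ((tendsto_rpow_neg_atTop hr).comp tendsto_natCast_atTop_atTop).const_mul c
        rwa [mul_zero] at this
      · exact mul_pos hc (Real.rpow_pos_of_pos hn _)
    have ht := ((tendsto_integral_profile (V := V) hN h₂ hγ h₁ hC₁ hC₂ hp hp_nonneg
      hp_cont).comp hlim).mul_const (c ^ r⁻¹)
    refine ht.congr' (hpos.mono fun n hn => ?_)
    have hden : ∀ F : (Fin k → ℝ) → ℝ,
        ∫ x, F x ∂(volume.withDensity fun x => ENNReal.ofReal (p x)) = ∫ x, p x * F x := by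
      intro F
      rw [integral_withDensity_eq_integral_toReal_smul hp.ennreal_ofReal
        (ae_of_all _ fun x => ENNReal.ofReal_lt_top)]
      simp only [ENNReal.toReal_ofReal (hp_nonneg _), smul_eq_mul]
    -- The normalization `b ^ (-1 / r)` of the integral equals `n` up to the factor `c ^ (-1 / r)`.
    have hb : (c * (n : ℝ) ^ (-r)) ^ (-r⁻¹) * c ^ r⁻¹ = n := by
      rw [Real.mul_rpow hc.le (Real.rpow_nonneg hn.le _), ← Real.rpow_mul hn.le, neg_mul_neg,
        mul_inv_cancel₀ hr.ne', Real.rpow_one, mul_right_comm, ← Real.rpow_add hc,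
        neg_add_cancel, Real.rpow_zero, one_mul]
    simp only [Function.comp, ← hrdef, Pi.pow_apply, hden]
    rw [mul_right_comm, hb]

/-- By continuity the density exceeds `p 0 / 2` on an open neighborhood of `0`, so every point there
is in the support. This makes the Hölder condition effective near the origin. -/
theorem support_withDensity_mem_nhds (hp_cont : ContinuousAt p 0) (hp_pos : 0 < p 0) :
    ((volume : Measure (Fin k → ℝ)).withDensity fun x => ENNReal.ofReal (p x)).support ∈ 𝓝 0 := by
  obtain ⟨U, hU, hUo, h0⟩ := mem_nhds_iff.1 (hp_cont.eventually (lt_mem_nhds (half_lt_self hp_pos)))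
  refine mem_nhds_iff.2 ⟨U, fun x hx => ?_, hUo, h0⟩
  refine (Measure.mem_support_iff_forall x).2 fun W hW => ?_
  obtain ⟨O, hO, hOo, hxO⟩ := mem_nhds_iff.1 (inter_mem hW (hUo.mem_nhds hx))
  refine lt_of_lt_of_le ?_ (measure_mono (hO.trans Set.inter_subset_left))
  rw [withDensity_apply _ hOo.measurableSet]
  have hvol : 0 < volume O := hOo.measure_pos volume ⟨x, hxO⟩
  calc 0 < ENNReal.ofReal (p 0 / 2) * volume O :=
        ENNReal.mul_pos (ENNReal.ofReal_pos.2 (half_pos hp_pos)).ne' hvol.ne'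
    _ = ∫⁻ _ in O, ENNReal.ofReal (p 0 / 2) := (setLIntegral_const _ _).symm
    _ ≤ _ := setLIntegral_mono' hOo.measurableSet fun y hy =>
        ENNReal.ofReal_le_ofReal (le_of_lt (hU (hO hy).2))

theorem map_neg_eq_withDensity (hX : ∀ i, Measurable (X i)) (hp : Measurable p)
    (hdens : ∀ i, P.map (X i) = volume.withDensity (fun x => ENNReal.ofReal (p x))) (i : ℕ) :
    P.map (fun a => -X i a) = volume.withDensity (fun x => ENNReal.ofReal (p (-x))) := by
  have h : P.map (fun a => -X i a) = (P.map (X i)).map Neg.neg :=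
    (Measure.map_map measurable_neg (hX i)).symm
  rw [h, hdens i]
  ext s hs
  rw [Measure.map_apply measurable_neg hs, withDensity_apply _ (measurable_neg hs),
    withDensity_apply _ hs]
  have hmp : MeasurePreserving (Neg.neg : (Fin k → ℝ) → Fin k → ℝ) volume volume :=
    Measure.measurePreserving_neg volume
  have := hmp.setLIntegral_comp_preimage hs
    (f := fun x => ENNReal.ofReal (p (-x))) (hp.comp measurable_neg).ennreal_ofReal
  simpa only [neg_neg] using this

end Design

end MonotoneHolder

/-! ### Assembly of the limit theorem -/

theorem theorem2 {k : ℕ} (N : Seminorm ℝ (Fin k → ℝ)) (hN : MonotoneHolder.IsMonotoneNorm N)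
    (V : Finset (Fin k)) (γ₁ C₁ γ₂ C₂ : ℝ)
    (hγ₂ : 0 < γ₂) (hγ : γ₂ ≤ γ₁) (hγ₁ : γ₁ ≤ 1) (hC₁ : 0 < C₁) (hC : C₁ ≤ C₂)
    {Ω : Type*} [MeasurableSpace Ω] (P : Measure Ω) [IsProbabilityMeasure P]
    (X : ℕ → Ω → Fin k → ℝ) (hX : ∀ i, Measurable (X i)) (hindep : iIndepFun X P)
    (p : (Fin k → ℝ) → ℝ) (hp : Measurable p) (hp_nonneg : ∀ x, 0 ≤ p x)
    (hdens : ∀ i, P.map (X i) = volume.withDensity (fun x => ENNReal.ofReal (p x)))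
    (hp_cont : ContinuousAt p 0) (hp_pos : 0 < p 0)
    (S : Set (Fin k → ℝ)) (hS : S = (P.map (X 0)).support)
    (c₁₂ c₂₁ : ℝ) (hc₁₂ : c₁₂ = p 0 * MonotoneHolder.kappa12 N V γ₁ C₁ γ₂ C₂)
    (hc₂₁ : c₂₁ = p 0 * MonotoneHolder.kappa21 N V γ₁ C₁ γ₂ C₂) :
    0 < c₁₂ ∧ 0 < c₂₁ ∧
    ∀ᵐ a ∂P, ∀ δ : ℝ, 0 < δ →
      Tendsto (fun n : ℕ => (n : ℝ) ^ MonotoneHolder.rateExponent V γ₁ γ₂ *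
          MonotoneHolder.orderedModulus (fun _ => 1) (fun i => X i a) n δ
            (MonotoneHolder.monotoneHolderClass N S V γ₁ C₁)
            (MonotoneHolder.monotoneHolderClass N S V γ₂ C₂))
        atTop (𝓝 ((δ ^ 2 / c₁₂) ^ MonotoneHolder.rateExponent V γ₁ γ₂)) ∧
      Tendsto (fun n : ℕ => (n : ℝ) ^ MonotoneHolder.rateExponent V γ₁ γ₂ *
          MonotoneHolder.orderedModulus (fun _ => 1) (fun i => X i a) n δ
            (MonotoneHolder.monotoneHolderClass N S V γ₂ C₂)
            (MonotoneHolder.monotoneHolderClass N S V γ₁ C₁))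
        atTop (𝓝 ((δ ^ 2 / c₂₁) ^ MonotoneHolder.rateExponent V γ₁ γ₂)) ∧
      Tendsto (fun n : ℕ => (n : ℝ) ^ MonotoneHolder.rateExponent V γ₁ γ₂ *
          MonotoneHolder.betweenModulus (fun _ => 1) (fun i => X i a) n δ
            (MonotoneHolder.monotoneHolderClass N S V γ₁ C₁)
            (MonotoneHolder.monotoneHolderClass N S V γ₂ C₂))
        atTop (𝓝 ((max (δ ^ 2 / c₁₂) (δ ^ 2 / c₂₁)) ^
          MonotoneHolder.rateExponent V γ₁ γ₂)) := by
  have h₁0 := hγ₂.trans_le hγ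
  have hC₂ := hC₁.trans_le hC
  have hκ := MonotoneHolder.kappa12_pos (V := V) hN hγ₂ hγ hC₁ hC₂
  have hc₂₁' : c₂₁ = c₁₂ := by rw [hc₂₁, hc₁₂, MonotoneHolder.kappa21_eq_kappa12]
  have hc : 0 < c₁₂ := by rw [hc₁₂]; exact mul_pos hp_pos hκ
  rw [hc₂₁']
  refine ⟨hc, hc, ?_⟩
  have hr : 0 < MonotoneHolder.rateExponent V γ₁ γ₂ := MonotoneHolder.rateExponent_pos h₁0 hγ₂
  have hS0 : S ∈ 𝓝 0 := by
    rw [hS, hdens 0]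
    exact MonotoneHolder.support_withDensity_mem_nhds hp_cont hp_pos
  have hS0' : -S ∈ 𝓝 0 := by
    have := continuous_neg.tendsto (0 : Fin k → ℝ)
    rw [neg_zero] at this
    exact this hS0
  -- Restricting to rational `c` gives one null set, and it does not depend on `δ`.
  have hae : ∀ᵐ a ∂P, ∀ c : ℚ, 0 < c → Tendsto (fun n : ℕ => ∑ i ∈ Finset.range n,
      MonotoneHolder.profile N V γ₁ C₁ γ₂ C₂
        (c * (n : ℝ) ^ (-MonotoneHolder.rateExponent V γ₁ γ₂)) (X i a) ^ 2) atTop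
      (𝓝 (c₁₂ * (c : ℝ) ^ (MonotoneHolder.rateExponent V γ₁ γ₂)⁻¹)) := by
    refine ae_all_iff.2 fun c => eventually_imp_distrib_left.2 fun hc0 => ?_
    rw [hc₁₂]
    exact MonotoneHolder.ae_tendsto_sum_profile hN hγ₂ hγ hγ₁ hC₁ hC₂ hX hindep hp hp_nonneg
      hdens hp_cont (by exact_mod_cast hc0)
  have hae' : ∀ᵐ a ∂P, ∀ c : ℚ, 0 < c → Tendsto (fun n : ℕ => ∑ i ∈ Finset.range n,
      MonotoneHolder.profile N V γ₁ C₁ γ₂ C₂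
        (c * (n : ℝ) ^ (-MonotoneHolder.rateExponent V γ₁ γ₂)) (-X i a) ^ 2) atTop
      (𝓝 (c₁₂ * (c : ℝ) ^ (MonotoneHolder.rateExponent V γ₁ γ₂)⁻¹)) := by
    refine ae_all_iff.2 fun c => eventually_imp_distrib_left.2 fun hc0 => ?_
    have hcont : ContinuousAt (fun x => p (-x)) 0 :=
      ContinuousAt.comp (g := p) (by simpa using hp_cont) continuous_neg.continuousAt
    have := MonotoneHolder.ae_tendsto_sum_profile (N := N) (V := V) hN hγ₂ hγ hγ₁ hC₁ hC₂
      (X := fun i a => -X i a) (fun i => (hX i).neg)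
      (hindep.comp (fun _ x => -x) fun _ => measurable_neg) (p := fun x => p (-x))
      (hp.comp measurable_neg) (fun x => hp_nonneg _)
      (MonotoneHolder.map_neg_eq_withDensity hX hp hdens) hcont (c := c) (by exact_mod_cast hc0)
    rwa [neg_zero, ← hc₁₂] at this
  filter_upwards [hae, hae'] with a ha ha' δ hδ
  obtain ⟨hne, hbd, hlim⟩ := MonotoneHolder.tendsto_orderedModulus (V := V) hN hS0 hγ₂ hγ hγ₁
    hC₁ hC hc hr hδ ha
  obtain ⟨-, hbd', hlim'⟩ := MonotoneHolder.tendsto_orderedModulus (V := V) hN hS0' hγ₂ hγ hγ₁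
    hC₁ hC hc hr hδ ha'
  simp only [← MonotoneHolder.gapSet_swap] at hbd' hlim'
  simp only [MonotoneHolder.orderedModulus_one]
  refine ⟨hlim, hlim', ?_⟩
  have hmax := hlim.max hlim'
  rw [max_self] at hmax ⊢
  refine hmax.congr' ?_
  -- The gap sets are known to be bounded only for large `n`, so the between class modulus is
  -- identified as a maximum only eventually.
  filter_upwards [hbd, hbd'] with n hn hn'
  rw [MonotoneHolder.betweenModulus_one (hne n) hn hn',
    mul_max_of_nonneg _ _ (Real.rpow_nonneg (Nat.cast_nonneg _) _)]
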